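/- \textbf{Setting.} Let $C,D\in\mathbb{N}$ and $A\subseteq\mathbb{R}^D$. For each component $j=1,\dots,C$ let $(\phi_{j,n})_{n\in\mathbb{B}_j}$ be a complete orthonormal system of mode functions in $L^2(A)$, and let $\mathbb{M}_j\subseteq\mathbb{B}_j$ be a finite set of retained modes. All integrals $\int d\boldsymbol{x}$ are over $A$. Let $\mathcal{H}$ be the bosonic Fock space of the modes $(j,n)$, $n\in\mathbb{M}_j$, with annihilation and creation operators $\hat a_{j,n},\hat a_{j,n}^\dagger$, and let $$\tilde\Psi_j(\boldsymbol{x})=\sum_{n\in\mathbb{M}_j}\phi_{j,n}(\boldsymbol{x})\,\hat a_{j,n},\qquad \tilde\Psi_j^\dagger(\boldsymbol{x})=\sum_{n\in\mathbb{M}_j}\phi_{j,n}^*(\boldsymbol{x})\,\hat a_{j,n}^\dagger$$ be the restricted field operators. Let $\mathbb{F}_{\mathbb{M}_j}$ be the span of $\{\phi_{j,n}:n\in\mathbb{M}_j\}$. For a functional $\mathcal{F}$ on $\prod_j\mathbb{F}_{\mathbb{M}_j}$ put $$\int\delta^2\boldsymbol{\Psi}\,\mathcal{F}[\boldsymbol{\Psi}]=\int\prod_{j}\prod_{n\in\mathbb{M}_j}d^2\alpha_{j,n}\;\mathcal{F}\Big[\Big(\sum_{n\in\mathbb{M}_j}\alpha_{j,n}\phi_{j,n}\Big)_{j}\Big],\qquad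 d^2\alpha=d\,\mathrm{Re}\,\alpha\;d\,\mathrm{Im}\,\alpha .$$ Let $\hat\rho$ be a density operator on $\mathcal{H}$ (positive, of trace one) for which all moments $\mathrm{Tr}(\hat\rho\hat N^p)$, $p\in\mathbb{N}$, of the total particle number $\hat N$ are finite, and write $\langle\hat X\rangle=\mathrm{Tr}(\hat\rho\hat X)$. With the displacement operators $$\hat D_j[\Lambda,\Lambda^*]=\exp\int d\boldsymbol{x}\,\big(\Lambda\tilde\Psi_j^\dagger-\Lambda^*\tilde\Psi_j\big),\qquad\Lambda\in\mathbb{F}_{\mathbb{M}_j},$$ the characteristic functional and the Wigner functional are $$\chi_W[\boldsymbol{\Lambda},\boldsymbol{\Lambda}^*]=\mathrm{Tr}\Big\{\hat\rho\prod_{j=1}^C\hat D_j[\Lambda_j,\Lambda_j^*]\Big\},$$ $$W[\boldsymbol{\Psi},\boldsymbol{\Psi}^*]=\frac{1}{\pi^{2\sum_j|\mathbb{M}_j|}}\int\delta^2\boldsymbol{\Lambda}\,\Big(\prod_{j=1}^C\exp\int d\boldsymbol{x}\,(-\Lambda_j\Psi_j^*+\Lambda_j^*\Psi_j)\Big)\,\chi_W[\boldsymbol{\Lambda},\boldsymbol{\Lambda}^*].$$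 For a product of $n$ operator factors, $\{\cdot\}_{\mathrm{sym}}$ denotes the average of the products over all $n!$ orderings of the factors. \textbf{Theorem.} For all non-negative integers $r_1,\dots,r_C$, $s_1,\dots,s_C$ and every point $\boldsymbol{x}\in\mathbb{R}^D$, $$\Big\langle\Big\{\prod_{j=1}^C\tilde\Psi_j(\boldsymbol{x})^{r_j}\,\big(\tilde\Psi_j^\dagger(\boldsymbol{x})\big)^{s_j}\Big\}_{\mathrm{sym}}\Big\rangle=\int\delta^2\boldsymbol{\Psi}\,\Big(\prod_{j=1}^C\Psi_j(\boldsymbol{x})^{r_j}\,\big(\Psi_j(\boldsymbol{x})^*\big)^{s_j}\Big)\,W[\boldsymbol{\Psi},\boldsymbol{\Psi}^*],$$ where the traces on the left and in $\chi_W$ converge absolutely (as sums of diagonal matrix elements over the number states), and so do the functional integral on the right and the one that defines $W$. -/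

import Mathlib

open MeasureTheory
open scoped ComplexConjugate InnerProductSpace

noncomputable section

namespace FuncWigner

/-! ### Fock space over a set `μ` of bosonic modes -/

/-- Occupation numbers of the modes. -/
abbrev Occupation (μ : Type*) := μ →₀ ℕ

/-- Finite linear combinations of number states: the common invariant domain of all polynomials
in the (unbounded) creation and annihilation operators. -/
abbrev FockCore (μ : Type*) := Occupation μ →₀ ℂ

/-- The bosonic Fock space, as the Hilbert space `ℓ²` with the number states as orthonormal
basis. -/
abbrev FockSpace (μ : Type*) := lp (fun _ : Occupation μ => ℂ) 2

open Classical in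
/-- The normalised number state `|k⟩`. -/
def numberState {μ : Type*} (k : Occupation μ) : FockSpace μ := lp.single 2 k (1 : ℂ)

/-- The inclusion of the finite linear combinations of number states into Fock space. -/
def toFock (μ : Type*) : FockCore μ →ₗ[ℂ] FockSpace μ :=
  Finsupp.linearCombination ℂ numberState

/-- The annihilation operator `a_n |k⟩ = √k_n |k - 1_n⟩`. -/
def annihilation {μ : Type*} (n : μ) : Module.End ℂ (FockCore μ) :=
  Finsupp.linearCombination ℂ fun k =>
    Finsupp.single (k - Finsupp.single n 1) ((Real.sqrt (k n) : ℝ) : ℂ)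

/-- The creation operator `a_n† |k⟩ = √(k_n + 1) |k + 1_n⟩`. -/
def creation {μ : Type*} (n : μ) : Module.End ℂ (FockCore μ) :=
  Finsupp.linearCombination ℂ fun k =>
    Finsupp.single (k + Finsupp.single n 1) ((Real.sqrt (k n + 1) : ℝ) : ℂ)

/-- The exponential `exp G` of an operator `G` defined on finite combinations of number states:
it is given on each number state by the norm-convergent series `∑ p, G ^ p / p!`, on their
combinations by linearity, and on the whole Fock space by continuous extension. (For the
generators of displacements the series converges on every number state and defines an isometry,
so that the extension exists.) -/
def expOperator {μ : Type*} (G : Module.End ℂ (FockCore μ)) : FockSpace μ →L[ℂ] FockSpace μ :=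
  (Finsupp.linearCombination ℂ fun k : Occupation μ =>
    ∑' p : ℕ, ((p.factorial : ℂ)⁻¹) • toFock μ ((G ^ p) (Finsupp.single k 1))).extendOfNorm
      (toFock μ)

/-- The diagonal matrix elements `⟨k| T |k⟩` of a bounded operator. -/
def diagonal {μ : Type*} (T : FockSpace μ →L[ℂ] FockSpace μ) (k : Occupation μ) : ℂ :=
  ⟪numberState k, T (numberState k)⟫_ℂ

/-- The trace `Tr T = ∑ k, ⟨k| T |k⟩` of a bounded operator. -/
def trace {μ : Type*} (T : FockSpace μ →L[ℂ] FockSpace μ) : ℂ :=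
  ∑' k, diagonal T k

/-- Density operators on Fock space: positive operators of trace one. -/
structure DensityOperator (μ : Type*) where
  op : FockSpace μ →L[ℂ] FockSpace μ
  isPositive : op.IsPositive
  trace_eq_one : HasSum (diagonal op) 1

/-- All moments `⟨N ^ p⟩` of the total particle number `N` are finite in the state `ρ`. -/
def DensityOperator.HasFiniteMoments {μ : Type*} (ρ : DensityOperator μ) : Prop :=
  ∀ p : ℕ, Summable fun k : Occupation μ => (k.degree : ℝ) ^ p * (diagonal ρ.op k).re

/-- The diagonal matrix elements `⟨k| ρ X |k⟩`, for `X` a polynomial in the creation and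
annihilation operators. -/
def DensityOperator.diagonalMul {μ : Type*} (ρ : DensityOperator μ)
    (X : Module.End ℂ (FockCore μ)) (k : Occupation μ) : ℂ :=
  ⟪numberState k, ρ.op (toFock μ (X (Finsupp.single k 1)))⟫_ℂ

/-- The expectation `⟨X⟩ = Tr (ρ X)`. -/
def DensityOperator.expectation {μ : Type*} (ρ : DensityOperator μ)
    (X : Module.End ℂ (FockCore μ)) : ℂ :=
  ∑' k, ρ.diagonalMul X k

/-- The symmetrically ordered product of a list of operators: the average of their products over
all orderings of the factors. -/
def symProd {R : Type*} [Ring R] [Algebra ℂ R] (l : List R) : R :=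
  ((l.length.factorial : ℂ)⁻¹) •
    ∑ σ : Equiv.Perm (Fin l.length), (List.ofFn fun i => l.get (σ i)).prod

/-! ### Mode functions, restricted functions, and functional integration -/

/-- Coordinate space. -/
abbrev Coord (D : ℕ) := EuclideanSpace ℝ (Fin D)

open Classical in
/-- A complete orthonormal system `φ n`, `n : ι`, of mode functions on the region `A`. -/
structure ModeBasis {D : ℕ} (A : Set (Coord D)) (ι : Type*) where
  φ : ι → Coord D → ℂ
  memLp : ∀ n, MemLp (φ n) 2 (volume.restrict A)
  orthonormal : ∀ n m, ∫ x in A, conj (φ n x) * φ m x = if n = m then 1 else 0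
  complete : ∀ f : Coord D → ℂ, MemLp f 2 (volume.restrict A) →
    (∀ n, ∫ x in A, conj (φ n x) * f x = 0) → f =ᵐ[volume.restrict A] 0

/-- The mode expansion `α ↦ ∑ n ∈ M, α n φ n`. -/
def composeFun {D : ℕ} {A : Set (Coord D)} {ι : Type*} (b : ModeBasis A ι) (M : Finset ι) :
    (M → ℂ) →ₗ[ℂ] (Coord D → ℂ) :=
  Fintype.linearCombination ℂ fun n : M => b.φ n

/-- The space of restricted functions, i.e. combinations of the modes in `M`. -/
abbrev Restricted {D : ℕ} {A : Set (Coord D)} {ι : Type*} (b : ModeBasis A ι) (M : Finset ι) :=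
  LinearMap.range (composeFun b M)

/-- The composition transformation from mode amplitudes to restricted functions. -/
def compose {D : ℕ} {A : Set (Coord D)} {ι : Type*} (b : ModeBasis A ι) (M : Finset ι)
    (α : M → ℂ) : Restricted b M :=
  (composeFun b M).rangeRestrict α

section Fields

variable {C D : ℕ} {A : Set (Coord D)} {B : Fin C → Type*}
  (b : ∀ j, ModeBasis A (B j)) (M : ∀ j, Finset (B j))

/-- The retained modes of all components: pairs `(j, n)` with `n ∈ M j`. -/
abbrev Mode {C : ℕ} {B : Fin C → Type*} (M : ∀ j, Finset (B j)) := Σ j, M j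

/-- Tuples `(Ψ_1, …, Ψ_C)` of restricted functions, the arguments of functionals. -/
abbrev FieldConfig := ∀ j, Restricted (b j) (M j)

/-- The functional integral `∫ δ²Ψ F[Ψ]` over tuples of restricted functions: the Lebesgue
integral over the real and imaginary parts of all mode amplitudes. -/
def funcIntegral (F : FieldConfig b M → ℂ) : ℂ :=
  ∫ α : (j : Fin C) → M j → ℂ, F fun j => compose (b j) (M j) (α j)

/-- Absolute convergence of the functional integral of `F`. -/
def FuncIntegrable (F : FieldConfig b M → ℂ) : Prop :=
  Integrable fun α : (j : Fin C) → M j → ℂ => F fun j => compose (b j) (M j) (α j)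

/-- The restricted field operator `Ψ_j(x) = ∑ n ∈ M_j, φ_{j,n}(x) a_{j,n}`. -/
def fieldOp (j : Fin C) (x : Coord D) : Module.End ℂ (FockCore (Mode M)) :=
  ∑ n : M j, (b j).φ n x • annihilation (⟨j, n⟩ : Mode M)

/-- The restricted field operator `Ψ_j†(x) = ∑ n ∈ M_j, φ_{j,n}(x)^* a_{j,n}†`. -/
def fieldOpDag (j : Fin C) (x : Coord D) : Module.End ℂ (FockCore (Mode M)) :=
  ∑ n : M j, conj ((b j).φ n x) • creation (⟨j, n⟩ : Mode M)

/-- The operator `∫_A dx (Λ(x) Ψ_j†(x) - Λ(x)^* Ψ_j(x))`, with the mode sum of the field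
operators taken out of the integral; see `displacementGenerator_apply`. -/
def displacementGenerator (j : Fin C) (Λ : Restricted (b j) (M j)) :
    Module.End ℂ (FockCore (Mode M)) :=
  ∑ n : M j, ((∫ x in A, Λ.1 x * conj ((b j).φ n x)) • creation (⟨j, n⟩ : Mode M)
    - (∫ x in A, conj (Λ.1 x) * (b j).φ n x) • annihilation (⟨j, n⟩ : Mode M))

lemma memLp_restricted (j : Fin C) (Λ : Restricted (b j) (M j)) :
    MemLp Λ.1 2 (volume.restrict A) := by
  obtain ⟨f, α, rfl⟩ := Λ
  have h : MemLp (∑ n : M j, α n • (b j).φ n) 2 (volume.restrict A) :=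
    memLp_finsetSum' _ fun n _ => ((b j).memLp n).const_smul (α n)
  simpa [composeFun, Fintype.linearCombination_apply] using h

/-- The displacement generator is the integral over `A` of the operators
`Λ(x) Ψ_j†(x) - Λ(x)^* Ψ_j(x)`, taken on each vector and in each coordinate. -/
lemma displacementGenerator_apply (j : Fin C) (Λ : Restricted (b j) (M j))
    (v : FockCore (Mode M)) (k : Occupation (Mode M)) :
    displacementGenerator b M j Λ v k =
      ∫ x in A, (Λ.1 x * fieldOpDag b M j x v k - conj (Λ.1 x) * fieldOp b M j x v k) := by
  have hc : ∀ n : M j, Integrable (fun x => Λ.1 x * conj ((b j).φ n x)) (volume.restrict A) :=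
    fun n => (memLp_restricted b M j Λ).integrable_mul ((b j).memLp n).star
  have ha : ∀ n : M j, Integrable (fun x => conj (Λ.1 x) * (b j).φ n x) (volume.restrict A) :=
    fun n => (memLp_restricted b M j Λ).star.integrable_mul ((b j).memLp n)
  have key : ∀ x, Λ.1 x * fieldOpDag b M j x v k - conj (Λ.1 x) * fieldOp b M j x v k =
      ∑ n : M j, ((Λ.1 x * conj ((b j).φ n x)) * creation (⟨j, n⟩ : Mode M) v k
        - (conj (Λ.1 x) * (b j).φ n x) * annihilation (⟨j, n⟩ : Mode M) v k) := by
    intro x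
    simp [fieldOp, fieldOpDag, Finset.mul_sum, Finsupp.finsetSum_apply, mul_assoc]
  simp_rw [key]
  rw [integral_finsetSum]
  · simp [displacementGenerator, integral_sub, (hc _).mul_const,
      (ha _).mul_const, integral_mul_const]
  · exact fun n _ => ((hc n).mul_const _).sub ((ha n).mul_const _)

/-- The functional displacement operator `D_j[Λ, Λ^*]`. -/
def displacementOp (j : Fin C) (Λ : Restricted (b j) (M j)) :
    FockSpace (Mode M) →L[ℂ] FockSpace (Mode M) :=
  expOperator (displacementGenerator b M j Λ)

/-- The displacement functional
`D[Λ, Λ^*, Ψ, Ψ^*] = exp ∫_A dx (-Λ(x) Ψ(x)^* + Λ(x)^* Ψ(x))`. -/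
def displacementFunctional (A : Set (Coord D)) (Λ Ψ : Coord D → ℂ) : ℂ :=
  Complex.exp (∫ x in A, (-(Λ x) * conj (Ψ x) + conj (Λ x) * Ψ x))

/-- The operator `ρ D_1[Λ_1] ⋯ D_C[Λ_C]`. -/
def displacedState (ρ : DensityOperator (Mode M)) (Λ : FieldConfig b M) :
    FockSpace (Mode M) →L[ℂ] FockSpace (Mode M) :=
  ρ.op * (List.ofFn fun j => displacementOp b M j (Λ j)).prod

/-- The characteristic functional `χ_W[Λ, Λ^*] = Tr (ρ D_1[Λ_1] ⋯ D_C[Λ_C])`. -/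
def charFunctional (ρ : DensityOperator (Mode M)) (Λ : FieldConfig b M) : ℂ :=
  trace (displacedState b M ρ Λ)

/-- The integrand `(∏ j, D[Λ_j, Λ_j^*, Ψ_j, Ψ_j^*]) χ_W[Λ, Λ^*]` of the Wigner functional. -/
def wignerIntegrand (ρ : DensityOperator (Mode M)) (Ψ Λ : FieldConfig b M) : ℂ :=
  (∏ j, displacementFunctional A (Λ j).1 (Ψ j).1) * charFunctional b M ρ Λ

/-- The Wigner functional `W[Ψ, Ψ^*]`. -/
def wignerFunctional (ρ : DensityOperator (Mode M)) (Ψ : FieldConfig b M) : ℂ :=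
  ((1 / Real.pi ^ (2 * ∑ j, (M j).card) : ℝ) : ℂ) * funcIntegral b M (wignerIntegrand b M ρ Ψ)

/-- The factors of `∏ j, Ψ_j(x) ^ r_j (Ψ_j†(x)) ^ s_j`. -/
def fieldFactors (r s : Fin C → ℕ) (x : Coord D) : List (Module.End ℂ (FockCore (Mode M))) :=
  (List.finRange C).flatMap fun j =>
    List.replicate (r j) (fieldOp b M j x) ++ List.replicate (s j) (fieldOpDag b M j x)

/-- The integrand `(∏ j, Ψ_j(x) ^ r_j (Ψ_j(x)^*) ^ s_j) W[Ψ, Ψ^*]`. -/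
def momentIntegrand (ρ : DensityOperator (Mode M)) (r s : Fin C → ℕ) (x : Coord D)
    (Ψ : FieldConfig b M) : ℂ :=
  (∏ j, (Ψ j).1 x ^ r j * conj ((Ψ j).1 x) ^ s j) * wignerFunctional b M ρ Ψ

end Fields

end FuncWigner

end

open FuncWigner

/-!
Moments of the Wigner functional are expectation values of symmetrically ordered products.

Expanding every field in the retained modes turns functional integrals into Lebesgue integrals
over the mode amplitudes, and the product of the displacement operators of the components into one
operator `D(α) = exp (gen α)`, where `gen α = ∑ n, (α n a_n† - conj (α n) a_n)`. The generators
satisfy the canonical commutation relations, the exponential series converges on number states,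
and rearranging it gives the Weyl relations and the isometry of `D(α)`.

*The characteristic function is a Schwartz function.* The matrix elements `⟨u| D(α) |w⟩` are
differentiable in `α`, with derivative `⟨u| (V D(α) + D(α) V) / 2 |w⟩` in the direction `β`, where
`V = gen β` (`hasFDerivAt_matElem`). Multiplication by an amplitude is a commutator:
`α n D(α) = a_n D(α) - D(α) a_n`. Hence the functions `Tr (ρ X D(α) Y)`, with `X` and `Y`
polynomials in the ladder operators, are closed under differentiation and under multiplication by
amplitudes. They are bounded, because the moments of the particle number are finite: by the
Cauchy-Schwarz inequality `|⟨k| ρ |l⟩|² ≤ ⟨k| ρ |k⟩ ⟨l| ρ |l⟩`, so the matrix elements of `ρ`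
decay rapidly. Thus `χ(α) = Tr (ρ D(α))` and all its derivatives decay rapidly (`charSchwartz`).

*Powers of one linear form.* The Wigner functional is the Fourier transform of `χ`, up to a linear
change of variables by the factor `i / π` whose Jacobian cancels the normalization. By Fourier
inversion at the origin, the integral of the `n`-th power of a linear form against the Wigner
functional is an `n`-th directional derivative of `χ` at `0`. Each differentiation puts a factor
`X`, the corresponding linear combination of ladder operators, on the left or on the right of
`D(α)`, with weight `1 / 2` each; since `D(0) = 1`, every resulting term is `Tr (ρ X ^ n)` at the
origin (`hasSum_diagonalMul_linOp_pow`). Complex directions are needed, because the field operators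
are not of the form `gen β`.

*Polarization.* The average of a product of linear forms over all orderings is a combination of
`n`-th powers of their partial sums, in noncommuting variables just as in commuting ones
(`sum_perm_prod_eq_sum_powers`). Applied to the operators and to their symbols, this extends the
identity for powers to all symmetrically ordered products (`hasSum_diagonalMul_symProd`).
-/

noncomputable section

namespace FuncWigner

/-! ### Creation and annihilation operators on number states -/

section Ladder

variable {μ : Type*}

lemma annihilation_single (n : μ) (k : Occupation μ) (c : ℂ) :
    annihilation n (Finsupp.single k c) =
      Finsupp.single (k - Finsupp.single n 1) (c * ((Real.sqrt (k n) : ℝ) : ℂ)) := by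
  simp [annihilation, Finsupp.linearCombination_single]

lemma creation_single (n : μ) (k : Occupation μ) (c : ℂ) :
    creation n (Finsupp.single k c) =
      Finsupp.single (k + Finsupp.single n 1) (c * ((Real.sqrt (k n + 1) : ℝ) : ℂ)) := by
  simp [creation, Finsupp.linearCombination_single]

lemma ofReal_sqrt_mul_self {x : ℝ} (hx : 0 ≤ x) : ((√x : ℝ) : ℂ) * ((√x : ℝ) : ℂ) = x := by
  rw [← Complex.ofReal_mul, Real.mul_self_sqrt hx]

lemma creation_mul_comm (m n : μ) : creation m * creation n = creation n * creation m := by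
  refine Finsupp.lhom_ext fun k c => ?_
  simp only [Module.End.mul_apply, creation_single, Finsupp.add_apply]
  rw [add_right_comm]
  congr 1
  by_cases h : m = n
  · subst h; rfl
  · rw [Finsupp.single_eq_of_ne (by tauto), Finsupp.single_eq_of_ne (by tauto)]
    push_cast; ring_nf

lemma annihilation_mul_comm (m n : μ) :
    annihilation m * annihilation n = annihilation n * annihilation m := by
  refine Finsupp.lhom_ext fun k c => ?_
  simp only [Module.End.mul_apply, annihilation_single, Finsupp.tsub_apply]
  rw [tsub_right_comm]
  congr 1
  by_cases h : m = n
  · subst h; rfl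
  · rw [Finsupp.single_eq_of_ne (by tauto), Finsupp.single_eq_of_ne (by tauto)]
    rw [Nat.sub_zero, Nat.sub_zero]; ring

lemma annihilation_mul_creation_of_ne {m n : μ} (h : m ≠ n) :
    annihilation m * creation n = creation n * annihilation m := by
  refine Finsupp.lhom_ext fun k c => ?_
  simp only [Module.End.mul_apply, annihilation_single, creation_single, Finsupp.tsub_apply,
    Finsupp.add_apply]
  rw [Finsupp.single_eq_of_ne (by tauto), Finsupp.single_eq_of_ne (by tauto)]
  by_cases hk : k m = 0
  · simp [hk]
  · congr 1
    · ext i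
      by_cases hi : i = m
      · subst hi
        simp [Finsupp.single_eq_of_ne h]
      · simp [Finsupp.single_eq_of_ne hi]
    · simp; ring

/-- The canonical commutation relation `a_n a_n† = a_n† a_n + 1`. -/
lemma annihilation_mul_creation_self (n : μ) :
    annihilation n * creation n = creation n * annihilation n + 1 := by
  refine Finsupp.lhom_ext fun k c => ?_
  simp only [Module.End.mul_apply, annihilation_single, creation_single, Finsupp.tsub_apply,
    Finsupp.add_apply, LinearMap.add_apply, Module.End.one_apply]
  rw [add_tsub_cancel_right, Finsupp.single_eq_same]
  by_cases hk : k n = 0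
  · simp [hk]
  · have h1 : 1 ≤ k n := Nat.one_le_iff_ne_zero.2 hk
    have h2 : k - Finsupp.single n 1 + Finsupp.single n 1 = k :=
      tsub_add_cancel_of_le (by simpa using h1)
    rw [h2, ← Finsupp.single_add]
    congr 1
    rw [Nat.cast_sub h1, mul_assoc, mul_assoc]
    have h3 : ((k n : ℝ) - (1 : ℕ) + 1) = k n := by push_cast; ring
    rw [h3, Nat.cast_add, Nat.cast_one, ofReal_sqrt_mul_self (by positivity),
      ofReal_sqrt_mul_self (by positivity)]
    push_cast; ring

lemma toFock_single (k : Occupation μ) (c : ℂ) :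
    toFock μ (Finsupp.single k c) = c • numberState k := by
  simp [toFock, Finsupp.linearCombination_single]

open Classical in
lemma inner_numberState (k l : Occupation μ) :
    ⟪(numberState k : FockSpace μ), numberState l⟫_ℂ = if k = l then 1 else 0 := by
  rw [numberState, lp.inner_single_left, numberState]
  simp [lp.single_apply, Pi.single_apply]

open Classical in
lemma norm_numberState (k : Occupation μ) : ‖(numberState k : FockSpace μ)‖ = 1 := by
  rw [numberState, lp.norm_single (by norm_num)]; simp

open Classical in
lemma inner_numberState_left (k : Occupation μ) (f : FockSpace μ) :
    ⟪numberState k, f⟫_ℂ = f k := by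
  rw [numberState, lp.inner_single_left]; simp

lemma inner_toFock_creation (n : μ) (u w : FockCore μ) :
    ⟪toFock μ (creation n u), toFock μ w⟫_ℂ = ⟪toFock μ u, toFock μ (annihilation n w)⟫_ℂ := by
  induction u using Finsupp.induction_linear with
  | zero => simp
  | add u v hu hv => simp only [map_add, inner_add_left, hu, hv]
  | single k c =>
    induction w using Finsupp.induction_linear with
    | zero => simp
    | add u v hu hv => simp only [map_add, inner_add_right, hu, hv]
    | single l d =>
      simp only [creation_single, annihilation_single, toFock_single, inner_smul_left,
        inner_smul_right, inner_numberState]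
      by_cases hl : l n = 0
      · have : k + Finsupp.single n 1 ≠ l := by
          rintro rfl; simp at hl
        simp [hl, this]
      · have h1 : 1 ≤ l n := Nat.one_le_iff_ne_zero.2 hl
        have h2 : k + Finsupp.single n 1 = l ↔ k = l - Finsupp.single n 1 :=
          (eq_tsub_iff_add_eq_of_le (by simpa using h1)).symm
        by_cases h : k = l - Finsupp.single n 1
        · rw [if_pos (h2.2 h), if_pos h, ← h2.2 h]
          simp; ring
        · rw [if_neg (h2.not.2 h), if_neg h]; simp

lemma inner_toFock_annihilation (n : μ) (u w : FockCore μ) :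
    ⟪toFock μ (annihilation n u), toFock μ w⟫_ℂ = ⟪toFock μ u, toFock μ (creation n w)⟫_ℂ := by
  rw [← inner_conj_symm, ← inner_toFock_creation, inner_conj_symm]

lemma denseRange_toFock : DenseRange (toFock μ) := by
  classical
  intro f
  have hf := lp.hasSum_single (p := 2) (by norm_num) f
  refine mem_closure_of_tendsto hf (Filter.Eventually.of_forall fun s => ?_)
  refine ⟨∑ k ∈ s, Finsupp.single k (f k), ?_⟩
  rw [map_sum]
  refine Finset.sum_congr rfl fun k _ => ?_
  rw [toFock_single, numberState, ← lp.single_smul, smul_eq_mul, mul_one]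

lemma continuousLinearMap_ext_toFock {S T : FockSpace μ →L[ℂ] FockSpace μ}
    (h : ∀ w, S (toFock μ w) = T (toFock μ w)) : S = T := by
  refine ContinuousLinearMap.ext fun x => ?_
  exact congrFun (denseRange_toFock.equalizer S.continuous T.continuous (funext h)) x

end Ladder

/-! ### The `ℓ¹` norm and the particle number -/

section OneNorm

variable {μ : Type*}

/-- The `ℓ¹` norm of the coefficients in the basis of number states. -/
def norm1 (u : FockCore μ) : ℝ := u.sum fun _ z => ‖z‖

lemma norm1_nonneg (u : FockCore μ) : 0 ≤ norm1 u :=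
  Finset.sum_nonneg fun _ _ => norm_nonneg _

@[simp] lemma norm1_zero : norm1 (0 : FockCore μ) = 0 := by simp [norm1]

@[simp] lemma norm1_single (k : Occupation μ) (c : ℂ) : norm1 (Finsupp.single k c) = ‖c‖ := by
  simp [norm1]

lemma norm1_eq_sum {u : FockCore μ} {s : Finset (Occupation μ)} (h : u.support ⊆ s) :
    norm1 u = ∑ k ∈ s, ‖u k‖ :=
  Finsupp.sum_of_support_subset _ h _ (by simp)

lemma norm1_add_le (u v : FockCore μ) : norm1 (u + v) ≤ norm1 u + norm1 v := by
  classical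
  rw [norm1_eq_sum (Finsupp.support_add : _ ⊆ u.support ∪ v.support),
    norm1_eq_sum (Finset.subset_union_left : _ ⊆ u.support ∪ v.support),
    norm1_eq_sum (Finset.subset_union_right : _ ⊆ u.support ∪ v.support),
    ← Finset.sum_add_distrib]
  exact Finset.sum_le_sum fun k _ => norm_add_le _ _

lemma norm1_smul (c : ℂ) (u : FockCore μ) : norm1 (c • u) = ‖c‖ * norm1 u := by
  rw [norm1_eq_sum (Finsupp.support_smul : _ ⊆ u.support), norm1, Finsupp.sum, Finset.mul_sum]
  simp

lemma norm1_sub_le (u v : FockCore μ) : norm1 (u - v) ≤ norm1 u + norm1 v := by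
  have := norm1_add_le u ((-1 : ℂ) • v)
  rw [norm1_smul] at this
  simpa [sub_eq_add_neg] using this

lemma norm1_sum_le {ι : Type*} (s : Finset ι) (f : ι → FockCore μ) :
    norm1 (∑ i ∈ s, f i) ≤ ∑ i ∈ s, norm1 (f i) := by
  classical
  induction s using Finset.induction_on with
  | empty => simp
  | insert i s hi ih =>
    rw [Finset.sum_insert hi, Finset.sum_insert hi]
    exact (norm1_add_le _ _).trans (by gcongr)

lemma norm_toFock_le (u : FockCore μ) : ‖toFock μ u‖ ≤ norm1 u := by
  rw [toFock, Finsupp.linearCombination_apply, norm1]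
  refine (norm_sum_le _ _).trans (Finset.sum_le_sum fun k _ => ?_)
  rw [norm_smul, norm_numberState, mul_one]

lemma norm1_linearCombination_le (f : Occupation μ → FockCore μ) (u : FockCore μ) (c : ℝ)
    (h : ∀ k ∈ u.support, norm1 (f k) ≤ c) :
    norm1 (Finsupp.linearCombination ℂ f u) ≤ c * norm1 u := by
  rw [Finsupp.linearCombination_apply, Finsupp.sum, norm1.eq_def u, Finsupp.sum, Finset.mul_sum]
  refine (norm1_sum_le _ _).trans (Finset.sum_le_sum fun k hk => ?_)
  rw [norm1_smul, mul_comm]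
  exact mul_le_mul_of_nonneg_right (h k hk) (norm_nonneg _)

/-- The combinations of number states with at most `K` particles. -/
def degLE (μ : Type*) (K : ℕ) : Submodule ℂ (FockCore μ) :=
  Finsupp.supported ℂ ℂ {k : Occupation μ | k.degree ≤ K}

lemma single_mem_degLE {k : Occupation μ} {K : ℕ} (h : k.degree ≤ K) (c : ℂ) :
    Finsupp.single k c ∈ degLE μ K :=
  Finsupp.single_mem_supported ℂ c h

lemma degLE_mono {K L : ℕ} (h : K ≤ L) : degLE μ K ≤ degLE μ L :=
  Finsupp.supported_mono fun _ hk => le_trans hk h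

lemma degree_le_of_mem {u : FockCore μ} {K : ℕ} (hu : u ∈ degLE μ K) {k : Occupation μ}
    (hk : k ∈ u.support) : k.degree ≤ K :=
  (Finsupp.mem_supported ℂ u).1 hu hk

lemma exists_mem_degLE (u : FockCore μ) : ∃ K, u ∈ degLE μ K :=
  ⟨u.support.sup fun k => k.degree, (Finsupp.mem_supported ℂ u).2 fun _ hk =>
    Finset.le_sup (f := fun k : Occupation μ => k.degree) hk⟩

lemma linearCombination_mem_degLE {f : Occupation μ → FockCore μ} {u : FockCore μ} {K : ℕ}
    (h : ∀ k ∈ u.support, f k ∈ degLE μ K) : Finsupp.linearCombination ℂ f u ∈ degLE μ K := by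
  rw [Finsupp.linearCombination_apply]
  exact Submodule.sum_mem _ fun k hk => Submodule.smul_mem _ _ (h k hk)

lemma degree_tsub_single_le (k : Occupation μ) (n : μ) :
    (k - Finsupp.single n 1).degree ≤ k.degree :=
  Finsupp.degree_mono tsub_le_self

lemma creation_mem_degLE (n : μ) {u : FockCore μ} {K : ℕ} (hu : u ∈ degLE μ K) :
    creation n u ∈ degLE μ (K + 1) :=
  linearCombination_mem_degLE fun k hk => single_mem_degLE
    (by rw [map_add, Finsupp.degree_single]; exact Nat.succ_le_succ (degree_le_of_mem hu hk)) _

lemma annihilation_mem_degLE (n : μ) {u : FockCore μ} {K : ℕ} (hu : u ∈ degLE μ K) :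
    annihilation n u ∈ degLE μ K :=
  linearCombination_mem_degLE fun k hk => single_mem_degLE
    ((degree_tsub_single_le k n).trans (degree_le_of_mem hu hk)) _

lemma norm1_creation_le (n : μ) {u : FockCore μ} {K : ℕ} (hu : u ∈ degLE μ K) :
    norm1 (creation n u) ≤ √(K + 1) * norm1 u := by
  refine norm1_linearCombination_le _ u _ fun k hk => ?_
  rw [norm1_single, Complex.norm_real, Real.norm_of_nonneg (Real.sqrt_nonneg _)]
  have : k n ≤ K := (Finsupp.le_degree n k).trans (degree_le_of_mem hu hk)
  gcongr

lemma norm1_annihilation_le (n : μ) {u : FockCore μ} {K : ℕ} (hu : u ∈ degLE μ K) :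
    norm1 (annihilation n u) ≤ √(K + 1) * norm1 u := by
  refine norm1_linearCombination_le _ u _ fun k hk => ?_
  rw [norm1_single, Complex.norm_real, Real.norm_of_nonneg (Real.sqrt_nonneg _)]
  have : k n ≤ K := (Finsupp.le_degree n k).trans (degree_le_of_mem hu hk)
  refine Real.sqrt_le_sqrt ?_
  have : (k n : ℝ) ≤ K := by exact_mod_cast this
  linarith

end OneNorm

/-! ### Displacement generators -/

lemma mul_pow_succ_of_commutator {R : Type*} [Semiring R] [Algebra ℂ R] {A G : R} {c : ℂ}
    (h : A * G = G * A + c • 1) (p : ℕ) :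
    A * G ^ (p + 1) = G ^ (p + 1) * A + ((p + 1) * c) • G ^ p := by
  induction p with
  | zero => simp [h]
  | succ p ih =>
    rw [pow_succ G (p + 1), ← mul_assoc, ih, add_mul, mul_assoc, h, mul_add, smul_mul_assoc,
      ← pow_succ, mul_smul_comm, mul_one, ← mul_assoc, add_assoc, ← add_smul]
    congr 2
    push_cast; ring

section Generator

variable {μ : Type*} [Fintype μ]

/-- The generator `∑ n, (α_n a_n† - α_n^* a_n)` of the displacement with amplitudes `α`. -/
def gen (α : μ → ℂ) : Module.End ℂ (FockCore μ) :=
  ∑ n, (α n • creation n + (-conj (α n)) • annihilation n)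

lemma gen_apply (α : μ → ℂ) (u : FockCore μ) :
    gen α u = ∑ n, (α n • creation n u - conj (α n) • annihilation n u) := by
  simp [gen, LinearMap.sum_apply, sub_eq_add_neg]

@[simp] lemma gen_zero : gen (0 : μ → ℂ) = 0 :=
  LinearMap.ext fun u => by simp [gen_apply]

lemma gen_add (α β : μ → ℂ) : gen (α + β) = gen α + gen β := by
  refine LinearMap.ext fun u => ?_
  simp only [gen_apply, LinearMap.add_apply, ← Finset.sum_add_distrib, Pi.add_apply, map_add,
    add_smul]
  exact Finset.sum_congr rfl fun n _ => by abel

lemma gen_neg_apply (α : μ → ℂ) (u : FockCore μ) : gen (-α) u = -gen α u := by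
  simp only [gen_apply, ← Finset.sum_neg_distrib, Pi.neg_apply, map_neg, neg_smul]
  exact Finset.sum_congr rfl fun n _ => by abel

lemma gen_sum {ι : Type*} (s : Finset ι) (α : ι → μ → ℂ) :
    gen (∑ i ∈ s, α i) = ∑ i ∈ s, gen (α i) := by
  classical
  induction s using Finset.induction_on with
  | empty => simp
  | insert i s hi ih => rw [Finset.sum_insert hi, Finset.sum_insert hi, gen_add, ih]

/-- Displacement generators are skew-adjoint. -/
lemma inner_toFock_gen (α : μ → ℂ) (u w : FockCore μ) :
    ⟪toFock μ (gen α u), toFock μ w⟫_ℂ = -⟪toFock μ u, toFock μ (gen α w)⟫_ℂ := by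
  simp only [gen_apply, map_sum, map_sub, map_smul, sum_inner, inner_sum, inner_sub_left,
    inner_sub_right, inner_smul_left, inner_smul_right, inner_toFock_creation,
    inner_toFock_annihilation, ← Finset.sum_neg_distrib, Complex.conj_conj]
  exact Finset.sum_congr rfl fun n _ => by ring

lemma inner_toFock_gen_pow (α : μ → ℂ) (p : ℕ) (u w : FockCore μ) :
    ⟪toFock μ ((gen α ^ p) u), toFock μ w⟫_ℂ =
      ⟪toFock μ u, toFock μ ((gen (-α) ^ p) w)⟫_ℂ := by
  induction p generalizing w with
  | zero => simp
  | succ p ih =>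
    rw [pow_succ', Module.End.mul_apply, inner_toFock_gen, pow_succ, Module.End.mul_apply,
      gen_neg_apply, map_neg, map_neg, inner_neg_right, ih]

lemma annihilation_mul_gen (n : μ) (α : μ → ℂ) :
    annihilation n * gen α = gen α * annihilation n + α n • 1 := by
  classical
  have h : ∀ m, annihilation n * (α m • creation m + (-conj (α m)) • annihilation m) =
      (α m • creation m + (-conj (α m)) • annihilation m) * annihilation n +
        if m = n then α n • (1 : Module.End ℂ (FockCore μ)) else 0 := by
    intro m
    rw [mul_add, mul_smul_comm, mul_smul_comm, add_mul, smul_mul_assoc, smul_mul_assoc,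
      annihilation_mul_comm n m]
    split_ifs with hm
    · subst hm
      rw [annihilation_mul_creation_self, smul_add]; abel
    · rw [annihilation_mul_creation_of_ne (Ne.symm hm), add_zero]
  rw [gen, Finset.mul_sum, Finset.sum_congr rfl fun m _ => h m, Finset.sum_add_distrib,
    Finset.sum_mul]
  simp

lemma creation_mul_gen (n : μ) (α : μ → ℂ) :
    creation n * gen α = gen α * creation n + conj (α n) • 1 := by
  classical
  have h : ∀ m, creation n * (α m • creation m + (-conj (α m)) • annihilation m) =
      (α m • creation m + (-conj (α m)) • annihilation m) * creation n +
        if m = n then conj (α n) • (1 : Module.End ℂ (FockCore μ)) else 0 := by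
    intro m
    rw [mul_add, mul_smul_comm, mul_smul_comm, add_mul, smul_mul_assoc, smul_mul_assoc,
      creation_mul_comm n m]
    split_ifs with hm
    · subst hm
      rw [annihilation_mul_creation_self, smul_add, add_assoc, add_assoc, ← add_smul,
        neg_add_cancel,
        zero_smul, add_zero]
    · rw [annihilation_mul_creation_of_ne hm, add_zero]
  rw [gen, Finset.mul_sum, Finset.sum_congr rfl fun m _ => h m, Finset.sum_add_distrib,
    Finset.sum_mul]
  simp

lemma gen_mul_gen (v α : μ → ℂ) :
    gen v * gen α = gen α * gen v + (∑ n, (v n * conj (α n) - conj (v n) * α n)) • 1 := by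
  rw [gen.eq_def v, Finset.sum_mul, Finset.mul_sum, Finset.sum_smul, ← Finset.sum_add_distrib]
  refine Finset.sum_congr rfl fun n _ => ?_
  rw [add_mul, smul_mul_assoc, smul_mul_assoc, creation_mul_gen, annihilation_mul_gen, mul_add,
    mul_smul_comm, mul_smul_comm, smul_add, smul_add, smul_smul, smul_smul, sub_eq_add_neg,
    add_smul, neg_mul]
  abel

lemma commute_gen_of_disjoint {α β : μ → ℂ} (h : ∀ n, α n = 0 ∨ β n = 0) :
    Commute (gen α) (gen β) := by
  rw [Commute, SemiconjBy, gen_mul_gen, Finset.sum_eq_zero, zero_smul, add_zero]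
  intro n _
  rcases h n with h | h <;> simp [h]

lemma gen_mem_degLE (α : μ → ℂ) {u : FockCore μ} {K : ℕ} (hu : u ∈ degLE μ K) :
    gen α u ∈ degLE μ (K + 1) := by
  rw [gen_apply]
  exact Submodule.sum_mem _ fun n _ => Submodule.sub_mem _
    (Submodule.smul_mem _ _ (creation_mem_degLE n hu))
    (Submodule.smul_mem _ _ (degLE_mono (Nat.le_succ K) (annihilation_mem_degLE n hu)))

lemma gen_pow_mem_degLE (α : μ → ℂ) {u : FockCore μ} {K : ℕ} (hu : u ∈ degLE μ K) (p : ℕ) :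
    (gen α ^ p) u ∈ degLE μ (K + p) := by
  induction p with
  | zero => simpa using hu
  | succ p ih =>
    rw [pow_succ', Module.End.mul_apply]
    exact gen_mem_degLE α ih

lemma norm1_gen_le {α : μ → ℂ} {R : ℝ} (hα : ∀ n, ‖α n‖ ≤ R) {u : FockCore μ} {K : ℕ}
    (hu : u ∈ degLE μ K) :
    norm1 (gen α u) ≤ (2 * Fintype.card μ * R) * √(K + 1) * norm1 u := by
  rw [gen_apply]
  refine (norm1_sum_le _ _).trans ?_
  have h : ∀ n ∈ Finset.univ, norm1 (α n • creation n u - conj (α n) • annihilation n u) ≤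
      2 * R * √(K + 1) * norm1 u := by
    intro n _
    refine (norm1_sub_le _ _).trans ?_
    rw [norm1_smul, norm1_smul, RCLike.norm_conj]
    have h1 := mul_le_mul (hα n) (norm1_creation_le n hu) (norm1_nonneg _)
      ((norm_nonneg _).trans (hα n))
    have h2 := mul_le_mul (hα n) (norm1_annihilation_le n hu) (norm1_nonneg _)
      ((norm_nonneg _).trans (hα n))
    linarith
  refine (Finset.sum_le_sum h).trans (le_of_eq ?_)
  rw [Finset.sum_const, nsmul_eq_mul, Finset.card_univ]; ring

lemma norm1_gen_pow_le {α : μ → ℂ} {R : ℝ} (hR : 0 ≤ R) (hα : ∀ n, ‖α n‖ ≤ R) {u : FockCore μ}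
    {K : ℕ} (hu : u ∈ degLE μ K) (p : ℕ) :
    norm1 ((gen α ^ p) u) * √(K.factorial) ≤
      (2 * Fintype.card μ * R) ^ p * √((K + p).factorial) * norm1 u := by
  induction p with
  | zero => simp [mul_comm]
  | succ p ih =>
    rw [pow_succ' (gen α), Module.End.mul_apply]
    have h := norm1_gen_le hα (gen_pow_mem_degLE α hu p)
    calc norm1 (gen α ((gen α ^ p) u)) * √(K.factorial)
        ≤ (2 * Fintype.card μ * R) * √((K + p : ℕ) + 1) * norm1 ((gen α ^ p) u) *
            √(K.factorial) := by gcongr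
      _ = (2 * Fintype.card μ * R) * √((K + p : ℕ) + 1) *
            (norm1 ((gen α ^ p) u) * √(K.factorial)) := by ring
      _ ≤ (2 * Fintype.card μ * R) * √((K + p : ℕ) + 1) *
            ((2 * Fintype.card μ * R) ^ p * √((K + p).factorial) * norm1 u) := by gcongr
      _ = (2 * Fintype.card μ * R) ^ (p + 1) * √((K + (p + 1)).factorial) * norm1 u := by
        rw [← add_assoc, Nat.factorial_succ, Nat.cast_mul, Real.sqrt_mul (by positivity)]
        push_cast; ring

/-- Words in displacement generators grow like the square root of a factorial. -/
lemma norm1_gen_pow_gen_pow_le {α β : μ → ℂ} {R : ℝ} (hR : 0 ≤ R) (hα : ∀ n, ‖α n‖ ≤ R)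
    (hβ : ∀ n, ‖β n‖ ≤ R) {u : FockCore μ} {K : ℕ} (hu : u ∈ degLE μ K) (p q : ℕ) :
    norm1 ((gen α ^ p) ((gen β ^ q) u)) ≤
      (2 * Fintype.card μ * R) ^ p * (2 * Fintype.card μ * R) ^ q * √((K + q + p).factorial) *
        norm1 u := by
  have h1 := norm1_gen_pow_le hR hα (gen_pow_mem_degLE β hu q) p
  have h2 := norm1_gen_pow_le hR hβ hu q
  have h3 : norm1 ((gen β ^ q) u) ≤
      (2 * Fintype.card μ * R) ^ q * √((K + q).factorial) * norm1 u := by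
    refine le_trans (le_mul_of_one_le_right (norm1_nonneg _) ?_) h2
    rw [Real.one_le_sqrt]
    exact_mod_cast Nat.one_le_iff_ne_zero.2 (Nat.factorial_ne_zero K)
  have h4 : 0 < √((K + q).factorial : ℝ) := Real.sqrt_pos.2 (by exact_mod_cast Nat.factorial_pos _)
  rw [← mul_le_mul_iff_left₀ h4]
  refine h1.trans ?_
  calc _ ≤ (2 * Fintype.card μ * R) ^ p * √((K + q + p).factorial) *
        ((2 * Fintype.card μ * R) ^ q * √((K + q).factorial) * norm1 u) := by gcongr
    _ = _ := by ring

end Generator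

/-! ### The exponential series -/

lemma sqrt_factorial_add_le (K p q : ℕ) :
    √((K + q + p).factorial : ℝ) ≤
      √(K.factorial) * 2 ^ K * ((2 ^ p * √(p.factorial)) * (2 ^ q * √(q.factorial))) := by
  have h : ∀ a b : ℕ, ((a + b).factorial : ℝ) ≤ 2 ^ (a + b) * (a.factorial * b.factorial) := by
    intro a b
    have h1 := Nat.add_choose_mul_factorial_mul_factorial a b
    have h2 := Nat.choose_le_two_pow (a + b) b
    have : (a + b).factorial ≤ 2 ^ (a + b) * (a.factorial * b.factorial) := by
      rw [← h1, mul_assoc]; exact Nat.mul_le_mul_right _ h2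
    exact_mod_cast this
  have h5 : ((K + q + p).factorial : ℝ) ≤
      (√(K.factorial) * 2 ^ K * ((2 ^ p * √(p.factorial)) * (2 ^ q * √(q.factorial)))) ^ 2 := by
    calc ((K + q + p).factorial : ℝ) ≤ 2 ^ (K + q + p) * ((K + q).factorial * p.factorial) := h _ _
      _ ≤ 2 ^ (K + q + p) * ((2 ^ (K + q) * (K.factorial * q.factorial)) * p.factorial) := by
        gcongr; exact h _ _
      _ = (2 ^ (K + q + p) * 2 ^ (K + q)) * (K.factorial * q.factorial * p.factorial) := by ring
      _ ≤ (2 ^ (K + q + p) * 2 ^ (K + q + p)) * (K.factorial * q.factorial * p.factorial) := by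
        refine mul_le_mul_of_nonneg_right (mul_le_mul_of_nonneg_left ?_ (by positivity))
          (by positivity)
        exact pow_le_pow_right₀ (by norm_num) (Nat.le_add_right _ _)
      _ = _ := by
        simp only [mul_pow]
        rw [Real.sq_sqrt (by positivity), Real.sq_sqrt (by positivity),
          Real.sq_sqrt (by positivity)]
        ring
  exact Real.sqrt_le_iff.2 ⟨by positivity, h5⟩

lemma summable_pow_div_sqrt_factorial (a : ℝ) (ha : 0 ≤ a) :
    Summable fun p : ℕ => a ^ p / √(p.factorial) := by
  rcases eq_or_lt_of_le ha with rfl | ha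
  · refine summable_of_ne_finset_zero (s := {0}) fun p hp => ?_
    rw [zero_pow (by simpa using hp), zero_div]
  have hs : ∀ p : ℕ, 0 < √(p.factorial : ℝ) := fun p =>
    Real.sqrt_pos.2 (by exact_mod_cast Nat.factorial_pos p)
  refine summable_of_ratio_test_tendsto_lt_one (l := 0) zero_lt_one
    (Filter.Eventually.of_forall fun p => (div_pos (pow_pos ha p) (hs p)).ne') ?_
  have h : ∀ p : ℕ, ‖a ^ (p + 1) / √((p + 1).factorial : ℝ)‖ / ‖a ^ p / √(p.factorial : ℝ)‖ =
      a / √((p + 1 : ℕ) : ℝ) := by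
    intro p
    have h1 : √((p + 1 : ℕ) : ℝ) ≠ 0 := (Real.sqrt_pos.2 (by positivity)).ne'
    rw [Real.norm_of_nonneg (div_pos (pow_pos ha _) (hs _)).le,
      Real.norm_of_nonneg (div_pos (pow_pos ha _) (hs _)).le, Nat.factorial_succ, Nat.cast_mul,
      Real.sqrt_mul (by positivity)]
    have := (hs p).ne'
    field_simp
    ring
  simp_rw [h]
  refine Filter.Tendsto.const_div_atTop ?_ a
  exact Real.tendsto_sqrt_atTop.comp (tendsto_natCast_atTop_atTop.comp
    (Filter.tendsto_add_atTop_nat 1))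

section Exponential

variable {μ : Type*} [Fintype μ]

/-- The bound on the terms of the exponential series is uniform for bounded amplitudes, as
termwise differentiation requires. -/
lemma norm_inv_factorial_smul_le {α β : μ → ℂ} {R : ℝ} (hR : 0 ≤ R) (hα : ∀ n, ‖α n‖ ≤ R)
    (hβ : ∀ n, ‖β n‖ ≤ R) {w : FockCore μ} {K : ℕ} (hw : w ∈ degLE μ K) (p q : ℕ) :
    ‖((p.factorial : ℂ)⁻¹ * (q.factorial : ℂ)⁻¹) • toFock μ ((gen α ^ p) ((gen β ^ q) w))‖ ≤
      √(K.factorial) * 2 ^ K * norm1 w * ((4 * Fintype.card μ * R) ^ p / √(p.factorial) *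
        ((4 * Fintype.card μ * R) ^ q / √(q.factorial))) := by
  have hp : (0 : ℝ) < √(p.factorial) := Real.sqrt_pos.2 (by exact_mod_cast Nat.factorial_pos p)
  have hq : (0 : ℝ) < √(q.factorial) := Real.sqrt_pos.2 (by exact_mod_cast Nat.factorial_pos q)
  have hp2 : (p.factorial : ℝ) = √(p.factorial) * √(p.factorial) :=
    (Real.mul_self_sqrt (by positivity)).symm
  have hq2 : (q.factorial : ℝ) = √(q.factorial) * √(q.factorial) :=
    (Real.mul_self_sqrt (by positivity)).symm
  rw [norm_smul, norm_mul, norm_inv, norm_inv, Complex.norm_natCast, Complex.norm_natCast]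
  calc _ ≤ ((p.factorial : ℝ)⁻¹ * (q.factorial : ℝ)⁻¹) *
        ((2 * Fintype.card μ * R) ^ p * (2 * Fintype.card μ * R) ^ q *
          (√(K.factorial) * 2 ^ K * ((2 ^ p * √(p.factorial)) * (2 ^ q * √(q.factorial)))) *
          norm1 w) := by
        refine mul_le_mul_of_nonneg_left ((norm_toFock_le _).trans
          ((norm1_gen_pow_gen_pow_le hR hα hβ hw p q).trans ?_)) (by positivity)
        refine mul_le_mul_of_nonneg_right (mul_le_mul_of_nonneg_left
          (sqrt_factorial_add_le K p q) (by positivity)) (norm1_nonneg _)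
    _ = _ := by
        have h4 : (4 : ℝ) * Fintype.card μ * R = 2 * (2 * Fintype.card μ * R) := by ring
        rw [h4, mul_pow 2 (2 * (Fintype.card μ : ℝ) * R) p,
          mul_pow 2 (2 * (Fintype.card μ : ℝ) * R) q]
        have e1 : (p.factorial : ℝ)⁻¹ * √(p.factorial) = (√(p.factorial))⁻¹ := by
          rw [inv_mul_eq_div, div_eq_iff (by positivity), inv_mul_eq_div, eq_div_iff hp.ne', ← hp2]
        have e2 : (q.factorial : ℝ)⁻¹ * √(q.factorial) = (√(q.factorial))⁻¹ := by
          rw [inv_mul_eq_div, div_eq_iff (by positivity), inv_mul_eq_div, eq_div_iff hq.ne', ← hq2]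
        rw [div_eq_mul_inv, div_eq_mul_inv, ← e1, ← e2]
        ring

lemma norm_inv_factorial_smul_le' {α : μ → ℂ} {R : ℝ} (hR : 0 ≤ R) (hα : ∀ n, ‖α n‖ ≤ R)
    {w : FockCore μ} {K : ℕ} (hw : w ∈ degLE μ K) (p : ℕ) :
    ‖(p.factorial : ℂ)⁻¹ • toFock μ ((gen α ^ p) w)‖ ≤
      √(K.factorial) * 2 ^ K * norm1 w * ((4 * Fintype.card μ * R) ^ p / √(p.factorial)) := by
  simpa using norm_inv_factorial_smul_le hR hα hα hw p 0

lemma norm_le_sum_norm (α : μ → ℂ) (n : μ) : ‖α n‖ ≤ ∑ m, ‖α m‖ :=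
  Finset.single_le_sum (f := fun m => ‖α m‖) (fun _ _ => norm_nonneg _) (Finset.mem_univ n)

lemma summable_double (α β : μ → ℂ) (w : FockCore μ) :
    Summable fun x : ℕ × ℕ => ((x.1.factorial : ℂ)⁻¹ * (x.2.factorial : ℂ)⁻¹) •
      toFock μ ((gen α ^ x.1) ((gen β ^ x.2) w)) := by
  obtain ⟨K, hw⟩ := exists_mem_degLE w
  have hR : 0 ≤ (∑ m, ‖α m‖) + ∑ m, ‖β m‖ :=
    add_nonneg (Finset.sum_nonneg fun _ _ => norm_nonneg _)
      (Finset.sum_nonneg fun _ _ => norm_nonneg _)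
  refine Summable.of_norm_bounded ?_ fun x => norm_inv_factorial_smul_le hR
    (fun n => (norm_le_sum_norm α n).trans (le_add_of_nonneg_right
      (Finset.sum_nonneg fun _ _ => norm_nonneg _)))
    (fun n => (norm_le_sum_norm β n).trans (le_add_of_nonneg_left
      (Finset.sum_nonneg fun _ _ => norm_nonneg _))) hw x.1 x.2
  have h := summable_pow_div_sqrt_factorial
    (4 * Fintype.card μ * ((∑ m, ‖α m‖) + ∑ m, ‖β m‖)) (by positivity)
  exact (h.mul_of_nonneg h (fun _ => by positivity) (fun _ => by positivity)).mul_left _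

lemma summable_exp (α : μ → ℂ) (w : FockCore μ) :
    Summable fun p : ℕ => (p.factorial : ℂ)⁻¹ • toFock μ ((gen α ^ p) w) := by
  have h := (summable_double α α w).comp_injective (i := fun p : ℕ => (p, 0))
    (fun _ _ h => (Prod.ext_iff.1 h).1)
  simpa [Function.comp_def] using h

/-- The norm-convergent exponential series of a displacement generator, as a linear map on the
finite combinations of number states. -/
def expLin (α : μ → ℂ) : FockCore μ →ₗ[ℂ] FockSpace μ where
  toFun w := ∑' p : ℕ, (p.factorial : ℂ)⁻¹ • toFock μ ((gen α ^ p) w)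
  map_add' u v := by
    rw [← (summable_exp α u).tsum_add (summable_exp α v)]
    simp only [map_add, smul_add]
  map_smul' c u := by
    rw [RingHom.id_apply, ← (summable_exp α u).tsum_const_smul c]
    simp only [map_smul, smul_comm c]

lemma hasSum_expLin (α : μ → ℂ) (w : FockCore μ) :
    HasSum (fun p : ℕ => (p.factorial : ℂ)⁻¹ • toFock μ ((gen α ^ p) w)) (expLin α w) :=
  (summable_exp α w).hasSum

lemma expLin_zero (w : FockCore μ) : expLin 0 w = toFock μ w := by
  have h := hasSum_ite_eq (0 : ℕ) (toFock μ w)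
  refine (hasSum_expLin 0 w).unique ?_
  convert h using 2 with p
  rcases p with _ | p <;> simp

/-- The Cauchy product of the exponential series of commuting generators. -/
lemma hasSum_double {α β : μ → ℂ} (h : Commute (gen α) (gen β)) (w : FockCore μ) :
    HasSum (fun x : ℕ × ℕ => ((x.1.factorial : ℂ)⁻¹ * (x.2.factorial : ℂ)⁻¹) •
      toFock μ ((gen α ^ x.1) ((gen β ^ x.2) w))) (expLin (α + β) w) := by
  have h3 : ∀ n : ℕ, ∑ x ∈ Finset.HasAntidiagonal.antidiagonal n,
      ((x.1.factorial : ℂ)⁻¹ * (x.2.factorial : ℂ)⁻¹) •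
        toFock μ ((gen α ^ x.1) ((gen β ^ x.2) w)) =
      (n.factorial : ℂ)⁻¹ • toFock μ ((gen (α + β) ^ n) w) := by
    intro n
    rw [gen_add, h.add_pow', LinearMap.sum_apply, map_sum, Finset.smul_sum]
    refine Finset.sum_congr rfl fun x hx => ?_
    rw [LinearMap.smul_apply, Module.End.mul_apply, map_nsmul, ← Nat.cast_smul_eq_nsmul ℂ,
      smul_smul]
    congr 1
    have hx' := Finset.HasAntidiagonal.mem_antidiagonal.1 hx
    have hc := Nat.add_choose_mul_factorial_mul_factorial x.1 x.2
    rw [hx', ← Nat.choose_symm_of_eq_add hx'.symm] at hc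
    have hc' : (n.choose x.1 : ℂ) * x.1.factorial * x.2.factorial = n.factorial := by
      exact_mod_cast hc
    have e1 : (x.1.factorial : ℂ) ≠ 0 := by exact_mod_cast Nat.factorial_ne_zero _
    have e2 : (x.2.factorial : ℂ) ≠ 0 := by exact_mod_cast Nat.factorial_ne_zero _
    have e3 : (n.factorial : ℂ) ≠ 0 := by exact_mod_cast Nat.factorial_ne_zero _
    field_simp
    rw [← hc']; ring
  have h1 := summable_double α β w
  generalize hf : (fun x : ℕ × ℕ => ((x.1.factorial : ℂ)⁻¹ * (x.2.factorial : ℂ)⁻¹) •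
      toFock μ ((gen α ^ x.1) ((gen β ^ x.2) w))) = f at h1 ⊢
  have h2 : HasSum (fun n : ℕ => ∑ x ∈ Finset.HasAntidiagonal.antidiagonal n, f x) (∑' x, f x) :=
    (Finset.HasAntidiagonal.sigmaAntidiagonalEquivProd.hasSum_iff.2 h1.hasSum).sigma fun n => by
      rw [← Finset.sum_coe_sort]
      exact hasSum_fintype _
  rw [← hf] at h2
  simp only [h3] at h2
  rw [(hasSum_expLin (α + β) w).unique h2, hf]
  exact h1.hasSum

lemma hasSum_expLin_comp {α β : μ → ℂ} (h : Commute (gen α) (gen β)) (w : FockCore μ) :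
    HasSum (fun q : ℕ => (q.factorial : ℂ)⁻¹ • expLin α ((gen β ^ q) w)) (expLin (α + β) w) := by
  have h1 := (Equiv.prodComm ℕ ℕ).hasSum_iff.2 (hasSum_double h w)
  refine h1.prod_fiberwise fun q => ?_
  have h2 := (hasSum_expLin α ((gen β ^ q) w)).const_smul (q.factorial : ℂ)⁻¹
  simpa [smul_smul, mul_comm] using h2

lemma inner_expLin_left (α : μ → ℂ) (u w : FockCore μ) :
    ⟪expLin α u, toFock μ w⟫_ℂ = ⟪toFock μ u, expLin (-α) w⟫_ℂ := by
  have h1 := (hasSum_expLin α u).mapL (innerSLFlip ℂ (toFock μ w))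
  have h2 := (hasSum_expLin (-α) w).mapL (innerSL ℂ (toFock μ u))
  refine h1.unique ?_
  convert h2 using 2 with p
  · simp [inner_toFock_gen_pow]
  · exact (innerSL_apply_apply ℂ _ _).symm

lemma commute_gen_neg (α : μ → ℂ) : Commute (gen (-α)) (gen α) := by
  refine LinearMap.ext fun u => ?_
  simp [Module.End.mul_apply, gen_neg_apply]

/-- The exponentials of displacement generators preserve inner products: the generators are
skew-adjoint. -/
lemma inner_expLin_expLin (α : μ → ℂ) (u w : FockCore μ) :
    ⟪expLin α u, expLin α w⟫_ℂ = ⟪toFock μ u, toFock μ w⟫_ℂ := by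
  have h1 := (hasSum_expLin α w).mapL (innerSL ℂ (expLin α u))
  have h2 := (hasSum_expLin_comp (commute_gen_neg α) w).mapL (innerSL ℂ (toFock μ u))
  rw [neg_add_cancel, expLin_zero] at h2
  refine h1.unique ?_
  convert h2 using 2 with p
  · simp [inner_expLin_left]
  · exact (innerSL_apply_apply ℂ _ _).symm

lemma norm_expLin (α : μ → ℂ) (w : FockCore μ) : ‖expLin α w‖ = ‖toFock μ w‖ := by
  rw [@norm_eq_sqrt_re_inner ℂ, inner_expLin_expLin, ← @norm_eq_sqrt_re_inner ℂ]

lemma expOperator_gen (α : μ → ℂ) : expOperator (gen α) = (expLin α).extendOfNorm (toFock μ) := by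
  rw [expOperator]
  congr 1
  refine Finsupp.lhom_ext fun k c => ?_
  rw [Finsupp.linearCombination_single, ← mul_one c, ← smul_eq_mul, ← Finsupp.smul_single,
    map_smul, smul_eq_mul, mul_one]
  rfl

lemma expOperator_gen_toFock (α : μ → ℂ) (w : FockCore μ) :
    expOperator (gen α) (toFock μ w) = expLin α w := by
  rw [expOperator_gen]
  exact LinearMap.extendOfNorm_eq denseRange_toFock
    ⟨1, fun w => by rw [norm_expLin, one_mul]⟩ w

lemma expOperator_gen_zero : expOperator (gen (0 : μ → ℂ)) = 1 :=
  continuousLinearMap_ext_toFock fun w => by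
    rw [expOperator_gen_toFock, expLin_zero, one_apply_eq_self]

lemma expOperator_gen_mul {α β : μ → ℂ} (h : Commute (gen α) (gen β)) :
    expOperator (gen α) * expOperator (gen β) = expOperator (gen (α + β)) := by
  refine continuousLinearMap_ext_toFock fun w => ?_
  rw [mul_apply_eq_comp, expOperator_gen_toFock, expOperator_gen_toFock]
  have h1 := (hasSum_expLin β w).mapL (expOperator (gen α))
  refine h1.unique ?_
  simpa [expOperator_gen_toFock] using hasSum_expLin_comp h w

end Exponential

/-! ### Matrix elements of displacement operators as functions of the amplitudes -/

/-- The space of mode amplitudes, as a Euclidean space; it is used as a real one. -/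
abbrev AmpSpace (μ : Type*) := PiLp 2 fun _ : μ => ℂ

section MatrixElements

variable {μ : Type*} [Fintype μ]

/-- The matrix elements `⟨u| D(α) |w⟩` of the displacement operators between finite
combinations of number states. -/
def matElem (α : μ → ℂ) (u w : FockCore μ) : ℂ := ⟪toFock μ u, expLin α w⟫_ℂ

lemma norm_matElem_le (α : μ → ℂ) (u w : FockCore μ) : ‖matElem α u w‖ ≤ norm1 u * norm1 w := by
  refine (norm_inner_le_norm _ _).trans ?_
  rw [norm_expLin]
  exact mul_le_mul (norm_toFock_le u) (norm_toFock_le w) (norm_nonneg _) (norm1_nonneg _)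

/-- The terms of the exponential series of a matrix element. -/
def matTerm (p : ℕ) (u w : FockCore μ) (α : μ → ℂ) : ℂ :=
  (p.factorial : ℂ)⁻¹ * ⟪toFock μ u, toFock μ ((gen α ^ p) w)⟫_ℂ

lemma hasSum_matTerm (α : μ → ℂ) (u w : FockCore μ) :
    HasSum (fun p => matTerm p u w α) (matElem α u w) := by
  have h := (hasSum_expLin α w).mapL (innerSL ℂ (toFock μ u))
  simp only [innerSL_apply_apply, inner_smul_right] at h
  exact h

lemma matElem_add_left (α : μ → ℂ) (u v w : FockCore μ) :
    matElem α (u + v) w = matElem α u w + matElem α v w := by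
  simp only [matElem, map_add, inner_add_left]

lemma matElem_add_right (α : μ → ℂ) (u v w : FockCore μ) :
    matElem α u (v + w) = matElem α u v + matElem α u w := by
  simp only [matElem, map_add, inner_add_right]

lemma matElem_smul_left (α : μ → ℂ) (c : ℂ) (u w : FockCore μ) :
    matElem α (c • u) w = conj c * matElem α u w := by
  simp only [matElem, map_smul, inner_smul_left]

lemma matElem_smul_right (α : μ → ℂ) (c : ℂ) (u w : FockCore μ) :
    matElem α u (c • w) = c * matElem α u w := by
  simp only [matElem, map_smul, inner_smul_right]

/-- An operator with scalar commutator `[A, G] = c` satisfies `[A, exp G] = c exp G`. -/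
lemma matElem_commutator {A A' : Module.End ℂ (FockCore μ)} {α : μ → ℂ} {c : ℂ}
    (h : A * gen α = gen α * A + c • 1)
    (hA : ∀ u w, ⟪toFock μ (A' u), toFock μ w⟫_ℂ = ⟪toFock μ u, toFock μ (A w)⟫_ℂ)
    (u w : FockCore μ) :
    matElem α (A' u) w = matElem α u (A w) + c * matElem α u w := by
  have h1 := (hasSum_matTerm α (A' u) w).sub (hasSum_matTerm α u (A w))
  have h2 := (hasSum_nat_add_iff' 1).2 h1
  have h3 : (fun p => matTerm (p + 1) (A' u) w α - matTerm (p + 1) u (A w) α) =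
      fun p => c * matTerm p u w α := by
    funext p
    have h4 := LinearMap.congr_fun (mul_pow_succ_of_commutator h p) w
    rw [Module.End.mul_apply, LinearMap.add_apply, Module.End.mul_apply,
      LinearMap.smul_apply] at h4
    have e3 : (p.factorial : ℂ) ≠ 0 := by exact_mod_cast Nat.factorial_ne_zero _
    have e4 : (p : ℂ) + 1 ≠ 0 := by exact_mod_cast Nat.succ_ne_zero p
    rw [matTerm, matTerm, matTerm, hA, h4, map_add, inner_add_right, map_smul, inner_smul_right,
      Nat.factorial_succ]
    push_cast
    field_simp
    ring
  rw [h3] at h2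
  have h5 := h2.unique ((hasSum_matTerm α u w).mul_left c)
  simp only [Finset.sum_range_one, matTerm, pow_zero, Module.End.one_apply, hA, sub_self,
    sub_zero] at h5
  rw [← h5]; ring

lemma mul_matElem (α : μ → ℂ) (n : μ) (u w : FockCore μ) :
    α n * matElem α u w = matElem α (creation n u) w - matElem α u (annihilation n w) := by
  rw [matElem_commutator (annihilation_mul_gen n α) (inner_toFock_creation n)]; ring

/-- The real-linear form `v ↦ ∑ n, (A_n v_n + B_n v_n^*)`. -/
def ampForm (A B : μ → ℂ) : AmpSpace μ →L[ℝ] ℂ :=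
  ∑ n, (A n • (PiLp.proj 2 (fun _ : μ => ℂ) n : AmpSpace μ →L[ℝ] ℂ) +
    B n • ((Complex.conjCLE : ℂ ≃L[ℝ] ℂ) : ℂ →L[ℝ] ℂ).comp
      (PiLp.proj 2 (fun _ : μ => ℂ) n : AmpSpace μ →L[ℝ] ℂ))

lemma ampForm_apply (A B : μ → ℂ) (v : AmpSpace μ) :
    ampForm A B v = ∑ n, (A n * v n + B n * conj (v n)) := by
  simp [ampForm]

lemma norm_ampForm_le (A B : μ → ℂ) : ‖ampForm A B‖ ≤ ∑ n, (‖A n‖ + ‖B n‖) := by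
  refine ContinuousLinearMap.opNorm_le_bound _
    (Finset.sum_nonneg fun _ _ => by positivity) fun v => ?_
  rw [ampForm_apply, Finset.sum_mul]
  refine (norm_sum_le _ _).trans (Finset.sum_le_sum fun n _ => (norm_add_le _ _).trans ?_)
  rw [norm_mul, norm_mul, RCLike.norm_conj, ← add_mul]
  exact mul_le_mul_of_nonneg_left (PiLp.norm_apply_le v n) (by positivity)

lemma hasSum_ampForm {ι : Type*} {A B : ι → μ → ℂ} {a b : μ → ℂ}
    (hA : ∀ n, HasSum (fun i => A i n) (a n)) (hB : ∀ n, HasSum (fun i => B i n) (b n)) :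
    HasSum (fun i => ampForm (A i) (B i)) (ampForm a b) :=
  hasSum_sum fun n _ => ((hA n).smul_const _).add ((hB n).smul_const _)

/-- The derivative of a power of the generator. Commutators of generators are scalars, so that
the derivative of `G ^ p` in the direction of a generator `V` is `(p / 2) (V G ^ (p - 1) +
G ^ (p - 1) V)`. -/
lemma hasFDerivAt_inner_gen_pow (p : ℕ) (u w : FockCore μ) (α : AmpSpace μ) :
    HasFDerivAt (fun α : AmpSpace μ => ⟪toFock μ u, toFock μ ((gen α.ofLp ^ p) w)⟫_ℂ)
      (ampForm
        (fun n => (p / 2 : ℂ) * (⟪toFock μ (annihilation n u),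
          toFock μ ((gen α.ofLp ^ (p - 1)) w)⟫_ℂ + ⟪toFock μ u,
          toFock μ ((gen α.ofLp ^ (p - 1)) (creation n w))⟫_ℂ))
        (fun n => (-(p / 2 : ℂ)) * (⟪toFock μ (creation n u),
          toFock μ ((gen α.ofLp ^ (p - 1)) w)⟫_ℂ + ⟪toFock μ u,
          toFock μ ((gen α.ofLp ^ (p - 1)) (annihilation n w))⟫_ℂ))) α := by
  have key : ∀ (q : ℕ) (c : ℂ) (u : FockCore μ) (v : AmpSpace μ), ampForm
        (fun n => c * (⟪toFock μ (annihilation n u),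
          toFock μ ((gen α.ofLp ^ q) w)⟫_ℂ + ⟪toFock μ u,
          toFock μ ((gen α.ofLp ^ q) (creation n w))⟫_ℂ))
        (fun n => (-c) * (⟪toFock μ (creation n u),
          toFock μ ((gen α.ofLp ^ q) w)⟫_ℂ + ⟪toFock μ u,
          toFock μ ((gen α.ofLp ^ q) (annihilation n w))⟫_ℂ)) v =
      c * (⟪toFock μ u, toFock μ (gen v.ofLp ((gen α.ofLp ^ q) w))⟫_ℂ +
        ⟪toFock μ u, toFock μ ((gen α.ofLp ^ q) (gen v.ofLp w))⟫_ℂ) := by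
    intro q c u v
    rw [ampForm_apply, gen_apply v.ofLp, gen_apply v.ofLp]
    simp only [map_sum, inner_sum, map_sub, map_smul, inner_sub_right, inner_smul_right,
      inner_toFock_creation, inner_toFock_annihilation, ← Finset.sum_add_distrib, Finset.mul_sum]
    exact Finset.sum_congr rfl fun n _ => by ring
  -- Induction by the product rule for `G ^ (p + 1) = G * G ^ p`, the outer factor being expanded
  -- in the amplitudes and moved to `u`.
  induction p generalizing u with
  | zero =>
    simp only [pow_zero, Module.End.one_apply]
    refine (hasFDerivAt_const (⟪toFock μ u, toFock μ w⟫_ℂ) α).congr_fderiv ?_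
    refine ContinuousLinearMap.ext fun v => ?_
    simp [ampForm_apply]
  | succ p ih =>
    have hexp : (fun α : AmpSpace μ => ⟪toFock μ u, toFock μ ((gen α.ofLp ^ (p + 1)) w)⟫_ℂ) =
        fun α : AmpSpace μ => ∑ n,
          (α n * ⟪toFock μ (annihilation n u), toFock μ ((gen α.ofLp ^ p) w)⟫_ℂ -
            conj (α n) * ⟪toFock μ (creation n u), toFock μ ((gen α.ofLp ^ p) w)⟫_ℂ) := by
      funext α
      rw [pow_succ', Module.End.mul_apply, gen_apply]
      simp only [map_sum, inner_sum, map_sub, map_smul, inner_sub_right, inner_smul_right,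
        inner_toFock_creation, inner_toFock_annihilation]
    rw [hexp]
    have hproj : ∀ n, HasFDerivAt (fun α : AmpSpace μ => α n)
        (PiLp.proj 2 (fun _ : μ => ℂ) n : AmpSpace μ →L[ℝ] ℂ) α := fun n =>
      (PiLp.proj 2 (fun _ : μ => ℂ) n : AmpSpace μ →L[ℝ] ℂ).hasFDerivAt
    have hconj : ∀ n, HasFDerivAt (fun α : AmpSpace μ => conj (α n))
        (((Complex.conjCLE : ℂ ≃L[ℝ] ℂ) : ℂ →L[ℝ] ℂ).comp
          (PiLp.proj 2 (fun _ : μ => ℂ) n : AmpSpace μ →L[ℝ] ℂ)) α := fun n =>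
      (((Complex.conjCLE : ℂ ≃L[ℝ] ℂ) : ℂ →L[ℝ] ℂ).comp
          (PiLp.proj 2 (fun _ : μ => ℂ) n : AmpSpace μ →L[ℝ] ℂ)).hasFDerivAt
    refine (HasFDerivAt.fun_sum fun n _ => ((hproj n).mul (ih (annihilation n u))).sub
      ((hconj n).mul (ih (creation n u)))).congr_fderiv ?_
    refine ContinuousLinearMap.ext fun v => ?_
    rw [key, sum_apply]
    simp only [_root_.sub_apply, _root_.add_apply,
      _root_.smul_apply, key, smul_eq_mul, ContinuousLinearMap.comp_apply,
      PiLp.proj_apply, ContinuousLinearEquiv.coe_coe, Complex.conjCLE_apply]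
    have h1 : ∀ x : FockCore μ, ⟪toFock μ u, toFock μ (gen v.ofLp x)⟫_ℂ =
        ∑ n, (v n * ⟪toFock μ (annihilation n u), toFock μ x⟫_ℂ -
          conj (v n) * ⟪toFock μ (creation n u), toFock μ x⟫_ℂ) := by
      intro x
      rw [gen_apply]
      simp only [map_sum, inner_sum, map_sub, map_smul, inner_sub_right, inner_smul_right,
        inner_toFock_creation, inner_toFock_annihilation]
    have h2 : ∀ x : FockCore μ, ⟪toFock μ u, toFock μ (gen α.ofLp x)⟫_ℂ =
        ∑ n, (α n * ⟪toFock μ (annihilation n u), toFock μ x⟫_ℂ -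
          conj (α n) * ⟪toFock μ (creation n u), toFock μ x⟫_ℂ) := by
      intro x
      rw [gen_apply]
      simp only [map_sum, inner_sum, map_sub, map_smul, inner_sub_right, inner_smul_right,
        inner_toFock_creation, inner_toFock_annihilation]
    trans ⟪toFock μ u, toFock μ (gen v.ofLp ((gen α.ofLp ^ p) w))⟫_ℂ + (p / 2 : ℂ) *
      (⟪toFock μ u, toFock μ (gen α.ofLp (gen v.ofLp ((gen α.ofLp ^ (p - 1)) w)))⟫_ℂ +
      ⟪toFock μ u, toFock μ (gen α.ofLp ((gen α.ofLp ^ (p - 1)) (gen v.ofLp w)))⟫_ℂ)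
    · rw [h1, h2, h2, ← Finset.sum_add_distrib, Finset.mul_sum, ← Finset.sum_add_distrib]
      exact Finset.sum_congr rfl fun n _ => by ring
    rw [Nat.add_sub_cancel]
    rcases p with _ | q
    · simp; ring
    -- With the scalar `c = [V, G]`, the terms `V G ^ p` and `G V G ^ (p - 1)` both differ from
    -- `G ^ p V` by multiples of `c G ^ (p - 1)`.
    · set c := ∑ n, (v n * conj (α n) - conj (v n) * α n)
      have hc : gen v.ofLp * gen α.ofLp = gen α.ofLp * gen v.ofLp + c • 1 :=
        gen_mul_gen v.ofLp α.ofLp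
      have e1 := LinearMap.congr_fun (mul_pow_succ_of_commutator hc q) w
      have e2 := LinearMap.congr_fun hc ((gen α.ofLp ^ q) w)
      rw [Module.End.mul_apply, LinearMap.add_apply, Module.End.mul_apply,
        LinearMap.smul_apply] at e1 e2
      rw [← Module.End.mul_apply (gen α.ofLp) (gen α.ofLp ^ q) w, ← pow_succ'] at e2
      rw [Nat.add_sub_cancel, ← Module.End.mul_apply (gen α.ofLp) (gen α.ofLp ^ q), ← pow_succ']
      rw [Module.End.one_apply] at e2
      have e3 := congrArg (fun x => ⟪toFock μ u, toFock μ x⟫_ℂ) e1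
      have e4 := congrArg (fun x => ⟪toFock μ u, toFock μ x⟫_ℂ) e2
      simp only [map_add, map_smul, inner_add_right, inner_smul_right] at e3 e4
      push_cast at e3 e4 ⊢
      linear_combination (-((q : ℂ) + 1) / 2) * e4 + (1 / 2 : ℂ) * e3

/-- The derivative of the displacement operators: in the direction of a generator `V` it is
`(V D + D V) / 2`, a symmetric expression in which the amplitudes no longer occur. -/
lemma hasFDerivAt_matElem (u w : FockCore μ) (α : AmpSpace μ) :
    HasFDerivAt (fun α : AmpSpace μ => matElem α.ofLp u w)
      (ampForm
        (fun n => (1 / 2 : ℂ) * (matElem α.ofLp (annihilation n u) w +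
          matElem α.ofLp u (creation n w)))
        (fun n => (-(1 / 2 : ℂ)) * (matElem α.ofLp (creation n u) w +
          matElem α.ofLp u (annihilation n w)))) α := by
  -- Termwise differentiation of the exponential series on the ball of radius `R`, with the summable
  -- bound `U` on the derivatives of the terms.
  set R : ℝ := ‖α‖ + 1 with hRdef
  have hR : 0 ≤ R := by positivity
  have hle : ∀ β ∈ Metric.ball (0 : AmpSpace μ) R, ∀ n, ‖β n‖ ≤ R := fun β hβ n =>
    (PiLp.norm_apply_le β n).trans (mem_ball_zero_iff.1 hβ).le
  let f' : ℕ → AmpSpace μ → (AmpSpace μ →L[ℝ] ℂ)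
    | 0, _ => 0
    | p + 1, β => ampForm
        (fun n => (1 / 2 : ℂ) * (matTerm p (annihilation n u) w β.ofLp +
          matTerm p u (creation n w) β.ofLp))
        (fun n => (-(1 / 2 : ℂ)) * (matTerm p (creation n u) w β.ofLp +
          matTerm p u (annihilation n w) β.ofLp))
  have hbound : ∀ u w : FockCore μ, ∃ C : ℝ, ∀ p, ∀ β ∈ Metric.ball (0 : AmpSpace μ) R,
      ‖matTerm p u w β.ofLp‖ ≤ C * ((4 * Fintype.card μ * R) ^ p / √(p.factorial)) := by
    intro u w
    obtain ⟨K, hw⟩ := exists_mem_degLE w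
    refine ⟨norm1 u * (√(K.factorial) * 2 ^ K * norm1 w), fun p β hβ => ?_⟩
    rw [matTerm, ← inner_smul_right, mul_assoc (norm1 u)]
    exact (norm_inner_le_norm _ _).trans (mul_le_mul (norm_toFock_le u)
      (norm_inv_factorial_smul_le' hR (hle β hβ) hw p) (norm_nonneg _) (norm1_nonneg _))
  choose C hC using hbound
  let S : ℝ := ∑ n, ((1 / 2) * (C (annihilation n u) w + C u (creation n w)) +
    (1 / 2) * (C (creation n u) w + C u (annihilation n w)))
  let U : ℕ → ℝ
    | 0 => 0
    | p + 1 => S * ((4 * Fintype.card μ * R) ^ p / √(p.factorial))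
  have hU : Summable U := (summable_nat_add_iff 1).1
    ((summable_pow_div_sqrt_factorial _ (by positivity)).mul_left S)
  have hf : ∀ p, ∀ β ∈ Metric.ball (0 : AmpSpace μ) R,
      HasFDerivAt (fun β : AmpSpace μ => matTerm p u w β.ofLp) (f' p β) β := by
    intro p β _
    refine ((hasFDerivAt_inner_gen_pow p u w β).const_mul (p.factorial : ℂ)⁻¹).congr_fderiv ?_
    refine ContinuousLinearMap.ext fun v => ?_
    rcases p with _ | p
    · simp [f', ampForm_apply]
    · have e3 : (p.factorial : ℂ) ≠ 0 := by exact_mod_cast Nat.factorial_ne_zero _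
      have e4 : (p : ℂ) + 1 ≠ 0 := by exact_mod_cast Nat.succ_ne_zero p
      simp only [f', _root_.smul_apply, ampForm_apply, smul_eq_mul, Finset.mul_sum, matTerm,
        Nat.add_sub_cancel, Nat.factorial_succ]
      refine Finset.sum_congr rfl fun n _ => ?_
      push_cast
      field_simp
  have hf' : ∀ p, ∀ β ∈ Metric.ball (0 : AmpSpace μ) R, ‖f' p β‖ ≤ U p := by
    intro p β hβ
    rcases p with _ | p
    · simp [f', U]
    · refine (norm_ampForm_le _ _).trans ?_
      simp only [U, S, Finset.sum_mul]
      refine Finset.sum_le_sum fun n _ => ?_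
      have hhalf : ‖(1 / 2 : ℂ)‖ = 1 / 2 := by norm_num
      rw [norm_mul, norm_mul, norm_neg, hhalf]
      have t1 := (norm_add_le (matTerm p (annihilation n u) w β.ofLp)
        (matTerm p u (creation n w) β.ofLp)).trans (add_le_add (hC _ _ p β hβ) (hC _ _ p β hβ))
      have t2 := (norm_add_le (matTerm p (creation n u) w β.ofLp)
        (matTerm p u (annihilation n w) β.ofLp)).trans (add_le_add (hC _ _ p β hβ) (hC _ _ p β hβ))
      linarith
  have hα : α ∈ Metric.ball (0 : AmpSpace μ) R := by
    rw [mem_ball_zero_iff, hRdef]; linarith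
  have main := hasFDerivAt_tsum_of_isPreconnected hU Metric.isOpen_ball
    (convex_ball (0 : AmpSpace μ) R).isPreconnected hf hf' hα
    (hasSum_matTerm α.ofLp u w).summable hα
  have h1 : (fun β : AmpSpace μ => ∑' p, matTerm p u w β.ofLp) =
      fun β : AmpSpace μ => matElem β.ofLp u w :=
    funext fun β => (hasSum_matTerm β.ofLp u w).tsum_eq
  rw [h1] at main
  refine main.congr_fderiv (HasSum.tsum_eq ?_)
  refine (hasSum_nat_add_iff' 1).1 ?_
  rw [Finset.sum_range_one, sub_zero]
  exact hasSum_ampForm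
    (fun n => ((hasSum_matTerm _ _ _).add (hasSum_matTerm _ _ _)).mul_left _)
    (fun n => ((hasSum_matTerm _ _ _).add (hasSum_matTerm _ _ _)).mul_left _)

end MatrixElements

/-! ### Matrix elements of density operators -/

section Counting

lemma summable_prod_comp {ι : Type*} [Fintype ι] {g : ℕ → ℝ} (h0 : ∀ n, 0 ≤ g n)
    (hg : Summable g) : Summable fun k : ι → ℕ => ∏ i, g (k i) := by
  classical
  refine summable_of_sum_le (c := ∏ _i : ι, ∑' n, g n)
    (fun k => Finset.prod_nonneg fun i _ => h0 _) fun s => ?_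
  have hs : s ⊆ Fintype.piFinset fun i => s.image fun k => k i := fun k hk =>
    Fintype.mem_piFinset.2 fun i => Finset.mem_image_of_mem _ hk
  refine (Finset.sum_le_sum_of_subset_of_nonneg hs fun k _ _ =>
    Finset.prod_nonneg fun i _ => h0 _).trans ?_
  rw [← Finset.prod_univ_sum (fun i : ι => s.image fun k => k i) fun _ n => g n]
  exact Finset.prod_le_prod (fun i _ => Finset.sum_nonneg fun _ _ => h0 _)
    fun i _ => hg.sum_le_tsum _ fun n _ => h0 n

/-- There are polynomially many number states of a given particle number. -/
lemma summable_inv_one_add_degree_pow (μ : Type*) [Fintype μ] :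
    Summable fun k : Occupation μ => ((1 + (k.degree : ℝ)) ^ (2 * Fintype.card μ))⁻¹ := by
  have h1 : Summable fun n : ℕ => ((1 + (n : ℝ)) ^ 2)⁻¹ := by
    have h := (summable_nat_add_iff 1).2 (Real.summable_nat_pow_inv.2 (one_lt_two : 1 < 2))
    refine h.congr fun n => ?_
    push_cast; rw [add_comm]
  have h2 := (Finsupp.equivFunOnFinite (α := μ) (M := ℕ)).summable_iff.2
    (summable_prod_comp (ι := μ) (fun n => by positivity) h1)
  refine Summable.of_nonneg_of_le (fun k => by positivity) (fun k => ?_) h2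
  simp only [Function.comp_apply, Finsupp.equivFunOnFinite_apply, Finset.prod_inv_distrib]
  refine inv_anti₀ (Finset.prod_pos fun n _ => by positivity) ?_
  rw [pow_mul, ← Finset.card_univ, ← Finset.prod_const]
  refine Finset.prod_le_prod (fun n _ => by positivity) fun n _ => ?_
  have : (k n : ℝ) ≤ k.degree := by exact_mod_cast Finsupp.le_degree n k
  gcongr

end Counting

section Density

variable {μ : Type*}

namespace DensityOperator

/-- The matrix elements `⟨k| ρ |l⟩`. -/
def elem (ρ : DensityOperator μ) (k l : Occupation μ) : ℂ :=
  ⟪numberState k, ρ.op (numberState l)⟫_ℂ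

/-- The populations `⟨k| ρ |k⟩` of the number states. -/
def population (ρ : DensityOperator μ) (k : Occupation μ) : ℝ := (diagonal ρ.op k).re

lemma population_nonneg (ρ : DensityOperator μ) (k : Occupation μ) : 0 ≤ ρ.population k :=
  ρ.isPositive.re_inner_nonneg_right (numberState k)

/-- The Cauchy–Schwarz inequality for the semi-inner product `⟨x| ρ |y⟩`. -/
lemma norm_elem_le (ρ : DensityOperator μ) (k l : Occupation μ) :
    ‖ρ.elem k l‖ ≤ √(ρ.population k) * √(ρ.population l) := by
  let c : PreInnerProductSpace.Core ℂ (FockSpace μ) :=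
    { inner := fun x y => ⟪x, ρ.op y⟫_ℂ
      conj_inner_symm := fun x y => by
        rw [inner_conj_symm, ρ.isPositive.inner_left_eq_inner_right]
      re_inner_nonneg := fun x => ρ.isPositive.re_inner_nonneg_right x
      add_left := fun x y z => inner_add_left _ _ _
      smul_left := fun x y r => inner_smul_left _ _ _ }
  have h := @InnerProductSpace.Core.inner_mul_inner_self_le ℂ (FockSpace μ) _ _ _ c
    (numberState k) (numberState l)
  have h1 : ‖⟪(numberState l : FockSpace μ), ρ.op (numberState k)⟫_ℂ‖ =
      ‖⟪(numberState k : FockSpace μ), ρ.op (numberState l)⟫_ℂ‖ := by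
    rw [← inner_conj_symm, RCLike.norm_conj, ρ.isPositive.inner_left_eq_inner_right]
  have h2 : ‖ρ.elem k l‖ * ‖ρ.elem k l‖ ≤ ρ.population k * ρ.population l := by
    have h' : ‖⟪(numberState k : FockSpace μ), ρ.op (numberState l)⟫_ℂ‖ *
      ‖⟪(numberState l : FockSpace μ), ρ.op (numberState k)⟫_ℂ‖ ≤
        ρ.population k * ρ.population l := h
    rwa [h1] at h'
  rw [← Real.sqrt_mul (ρ.population_nonneg k)]
  exact Real.le_sqrt_of_sq_le (by rw [sq]; exact h2)

/-- Matrix multiplication by `ρ` in the basis of number states. -/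
lemma hasSum_elem_mul_inner (ρ : DensityOperator μ) (k : Occupation μ) (f : FockSpace μ) :
    HasSum (fun l => ρ.elem k l * ⟪numberState l, f⟫_ℂ) ⟪numberState k, ρ.op f⟫_ℂ := by
  rw [← ρ.isPositive.inner_left_eq_inner_right]
  have h : (fun l => ρ.elem k l * ⟪numberState l, f⟫_ℂ) =
      fun l => ⟪ρ.op (numberState k) l, f l⟫_ℂ := by
    funext l
    rw [inner_numberState_left, DensityOperator.elem, ← ρ.isPositive.inner_left_eq_inner_right,
      ← inner_conj_symm, inner_numberState_left, RCLike.inner_apply, mul_comm]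
  rw [h]
  exact lp.hasSum_inner (ρ.op (numberState k)) f

lemma HasFiniteMoments.summable_one_add_pow {ρ : DensityOperator μ} (hρ : ρ.HasFiniteMoments)
    (p : ℕ) : Summable fun k : Occupation μ => (1 + (k.degree : ℝ)) ^ p * ρ.population k := by
  have h : Summable fun k : Occupation μ => 2 ^ p * (ρ.population k +
      (k.degree : ℝ) ^ p * ρ.population k) := by
    have h0 := hρ 0
    simp only [pow_zero, one_mul] at h0
    exact (h0.add (hρ p)).mul_left _
  refine Summable.of_nonneg_of_le
    (fun k => mul_nonneg (by positivity) (ρ.population_nonneg k)) (fun k => ?_) h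
  have h1 : (1 + (k.degree : ℝ)) ^ p ≤ 2 ^ p * (1 + (k.degree : ℝ) ^ p) := by
    rcases Nat.eq_zero_or_pos k.degree with h0 | h0
    · rw [h0]
      simp only [Nat.cast_zero, add_zero, one_pow]
      have : (1 : ℝ) ≤ 2 ^ p := one_le_pow₀ (by norm_num)
      nlinarith [pow_nonneg (le_refl (0 : ℝ)) p]
    · have h2 : (1 : ℝ) ≤ k.degree := by exact_mod_cast h0
      calc (1 + (k.degree : ℝ)) ^ p ≤ (2 * k.degree) ^ p := by gcongr; linarith
        _ = 2 ^ p * (k.degree : ℝ) ^ p := mul_pow _ _ _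
        _ ≤ _ := by gcongr; linarith
  calc _ ≤ 2 ^ p * (1 + (k.degree : ℝ) ^ p) * ρ.population k :=
        mul_le_mul_of_nonneg_right h1 (ρ.population_nonneg k)
    _ = _ := by ring

variable [Fintype μ]

lemma HasFiniteMoments.summable_sqrt {ρ : DensityOperator μ} (hρ : ρ.HasFiniteMoments)
    (p : ℕ) : Summable fun k : Occupation μ => (1 + (k.degree : ℝ)) ^ p * √(ρ.population k) := by
  have h := (hρ.summable_one_add_pow (2 * p + 2 * Fintype.card μ)).add
    (summable_inv_one_add_degree_pow μ)
  refine Summable.of_nonneg_of_le (fun k => by positivity) (fun k => ?_) h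
  -- The arithmetic-geometric mean inequality, with a weight that makes both terms summable.
  have hd : (0 : ℝ) < (1 + (k.degree : ℝ)) ^ Fintype.card μ := by positivity
  have h1 := two_mul_le_add_sq
    ((1 + (k.degree : ℝ)) ^ (p + Fintype.card μ) * √(ρ.population k))
    ((1 + (k.degree : ℝ)) ^ Fintype.card μ)⁻¹
  have h2 : (1 + (k.degree : ℝ)) ^ (p + Fintype.card μ) * √(ρ.population k) *
      ((1 + (k.degree : ℝ)) ^ Fintype.card μ)⁻¹ =
      (1 + (k.degree : ℝ)) ^ p * √(ρ.population k) := by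
    rw [pow_add]; field_simp
  have h3 : ((1 + (k.degree : ℝ)) ^ (p + Fintype.card μ) * √(ρ.population k)) ^ 2 =
      (1 + (k.degree : ℝ)) ^ (2 * p + 2 * Fintype.card μ) * ρ.population k := by
    rw [mul_pow, Real.sq_sqrt (ρ.population_nonneg k), ← pow_mul]; ring
  have h4 : (((1 + (k.degree : ℝ)) ^ Fintype.card μ)⁻¹) ^ 2 =
      ((1 + (k.degree : ℝ)) ^ (2 * Fintype.card μ))⁻¹ := by
    rw [inv_pow, ← pow_mul, mul_comm]
  rw [h3, h4, mul_assoc, h2] at h1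
  have h5 : 0 ≤ (1 + (k.degree : ℝ)) ^ p * √(ρ.population k) := by positivity
  linarith

/-- The matrix of a density operator with finite moments is rapidly decreasing. -/
lemma HasFiniteMoments.summable_elem {ρ : DensityOperator μ} (hρ : ρ.HasFiniteMoments)
    (p q : ℕ) : Summable fun x : Occupation μ × Occupation μ =>
      ‖ρ.elem x.1 x.2‖ * ((1 + (x.2.degree : ℝ)) ^ p * (1 + (x.1.degree : ℝ)) ^ q) := by
  have h := (hρ.summable_sqrt q).mul_of_nonneg (hρ.summable_sqrt p)
    (fun k => by positivity) (fun k => by positivity)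
  refine Summable.of_nonneg_of_le (fun x => by positivity) (fun x => ?_) h
  calc _ ≤ √(ρ.population x.1) * √(ρ.population x.2) *
        ((1 + (x.2.degree : ℝ)) ^ p * (1 + (x.1.degree : ℝ)) ^ q) :=
        mul_le_mul_of_nonneg_right (ρ.norm_elem_le x.1 x.2) (by positivity)
    _ = _ := by ring

end DensityOperator

end Density

/-! ### Families of polynomial growth -/

section Tempered

variable {μ : Type*}

/-- A family of vectors, indexed by the number states, of polynomial growth: applying a
polynomial in the creation and annihilation operators to all number states gives such a
family. -/
def Tempered (u : Occupation μ → FockCore μ) : Prop :=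
  ∃ (d p : ℕ) (C : ℝ), 0 ≤ C ∧ ∀ k, u k ∈ degLE μ (k.degree + d) ∧
    norm1 (u k) ≤ C * (1 + (k.degree : ℝ)) ^ p

lemma tempered_single : Tempered fun k : Occupation μ => Finsupp.single k (1 : ℂ) :=
  ⟨0, 0, 1, zero_le_one, fun _ => ⟨single_mem_degLE le_rfl _, by simp⟩⟩

lemma Tempered.of_bound {T : Module.End ℂ (FockCore μ)}
    (h1 : ∀ {u : FockCore μ} {K : ℕ}, u ∈ degLE μ K → T u ∈ degLE μ (K + 1))
    (h2 : ∀ {u : FockCore μ} {K : ℕ}, u ∈ degLE μ K → norm1 (T u) ≤ √(K + 1) * norm1 u)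
    {u : Occupation μ → FockCore μ} (hu : Tempered u) : Tempered fun k => T (u k) := by
  obtain ⟨d, p, C, hC, h⟩ := hu
  refine ⟨d + 1, p + 1, (d + 1) * C, by positivity, fun k => ⟨h1 (h k).1, ?_⟩⟩
  have h3 : √((k.degree + d : ℕ) + 1 : ℝ) ≤ (d + 1) * (1 + k.degree) := by
    refine Real.sqrt_le_iff.2 ⟨by positivity, ?_⟩
    push_cast
    have e1 : (0 : ℝ) ≤ k.degree := Nat.cast_nonneg _
    have e2 : (0 : ℝ) ≤ d := Nat.cast_nonneg _
    have e3 : (k.degree : ℝ) + d + 1 ≤ (d + 1) * (1 + k.degree) := by nlinarith [mul_nonneg e1 e2]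
    have e4 : (1 : ℝ) ≤ (d + 1) * (1 + k.degree) := by nlinarith [mul_nonneg e1 e2]
    nlinarith
  calc norm1 (T (u k)) ≤ √((k.degree + d : ℕ) + 1 : ℝ) * norm1 (u k) := h2 (h k).1
    _ ≤ ((d + 1) * (1 + k.degree)) * (C * (1 + (k.degree : ℝ)) ^ p) :=
        mul_le_mul h3 (h k).2 (norm1_nonneg _) (by positivity)
    _ = _ := by ring

lemma Tempered.creation {u : Occupation μ → FockCore μ} (hu : Tempered u) (n : μ) :
    Tempered fun k => creation n (u k) :=
  hu.of_bound (creation_mem_degLE n) (norm1_creation_le n)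

lemma Tempered.annihilation {u : Occupation μ → FockCore μ} (hu : Tempered u) (n : μ) :
    Tempered fun k => annihilation n (u k) :=
  hu.of_bound (fun h => degLE_mono (Nat.le_succ _) (annihilation_mem_degLE n h))
    (norm1_annihilation_le n)

lemma Tempered.add {u v : Occupation μ → FockCore μ} (hu : Tempered u) (hv : Tempered v) :
    Tempered fun k => u k + v k := by
  obtain ⟨d, p, C, hC, h⟩ := hu
  obtain ⟨d', p', C', hC', h'⟩ := hv
  refine ⟨d + d', p + p', C + C', by positivity, fun k => ⟨Submodule.add_mem _
    (degLE_mono (by omega) (h k).1) (degLE_mono (by omega) (h' k).1), ?_⟩⟩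
  have e : (1 : ℝ) ≤ 1 + k.degree := by simp
  calc norm1 (u k + v k) ≤ norm1 (u k) + norm1 (v k) := norm1_add_le _ _
    _ ≤ C * (1 + (k.degree : ℝ)) ^ p + C' * (1 + (k.degree : ℝ)) ^ p' :=
      add_le_add (h k).2 (h' k).2
    _ ≤ C * (1 + (k.degree : ℝ)) ^ (p + p') + C' * (1 + (k.degree : ℝ)) ^ (p + p') :=
      add_le_add
        (mul_le_mul_of_nonneg_left (pow_le_pow_right₀ e (Nat.le_add_right _ _)) hC)
        (mul_le_mul_of_nonneg_left (pow_le_pow_right₀ e (Nat.le_add_left _ _)) hC')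
    _ = _ := by ring

lemma Tempered.smul {u : Occupation μ → FockCore μ} (hu : Tempered u) (c : ℂ) :
    Tempered fun k => c • u k := by
  obtain ⟨d, p, C, hC, h⟩ := hu
  refine ⟨d, p, ‖c‖ * C, by positivity, fun k => ⟨Submodule.smul_mem _ _ (h k).1, ?_⟩⟩
  rw [norm1_smul, mul_assoc]
  exact mul_le_mul_of_nonneg_left (h k).2 (norm_nonneg _)

lemma tempered_zero : Tempered fun _ : Occupation μ => (0 : FockCore μ) :=
  ⟨0, 0, 0, le_rfl, fun _ => ⟨Submodule.zero_mem _, by simp⟩⟩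

lemma Tempered.sum {ι : Type*} (s : Finset ι) {u : ι → Occupation μ → FockCore μ}
    (hu : ∀ i, Tempered (u i)) : Tempered fun k => ∑ i ∈ s, u i k := by
  classical
  induction s using Finset.induction_on with
  | empty => simpa using tempered_zero
  | insert i s hi ih => simpa only [Finset.sum_insert hi] using (hu i).add ih

end Tempered

/-! ### Rapid decay of characteristic functions -/

section TracePair

variable {μ : Type*} [Fintype μ]

/-- The functions `α ↦ ∑ k l, ⟨k| ρ |l⟩ ⟨u_l| D(α) |w_k⟩`. For `u_l = X† |l⟩` and `w_k = Y |k⟩`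
this is `Tr (ρ X D(α) Y)`, and the characteristic function is the case `X = Y = 1`. -/
def tracePair (ρ : DensityOperator μ) (u w : Occupation μ → FockCore μ) (α : μ → ℂ) : ℂ :=
  ∑' x : Occupation μ × Occupation μ, ρ.elem x.1 x.2 * matElem α (u x.2) (w x.1)

variable {ρ : DensityOperator μ}

lemma exists_summable_bound (hρ : ρ.HasFiniteMoments) {u w : Occupation μ → FockCore μ}
    (hu : Tempered u) (hw : Tempered w) : ∃ b : Occupation μ × Occupation μ → ℝ, Summable b ∧
      ∀ (α : μ → ℂ) x, ‖ρ.elem x.1 x.2 * matElem α (u x.2) (w x.1)‖ ≤ b x := by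
  obtain ⟨_, p, C, hC, h⟩ := hu
  obtain ⟨_, q, C', hC', h'⟩ := hw
  refine ⟨_, (hρ.summable_elem p q).mul_left (C * C'), fun α x => ?_⟩
  rw [norm_mul]
  calc _ ≤ ‖ρ.elem x.1 x.2‖ * ((C * (1 + (x.2.degree : ℝ)) ^ p) *
        (C' * (1 + (x.1.degree : ℝ)) ^ q)) := by
        refine mul_le_mul_of_nonneg_left ((norm_matElem_le _ _ _).trans ?_) (norm_nonneg _)
        exact mul_le_mul (h _).2 (h' _).2 (norm1_nonneg _) (by positivity)
    _ = _ := by ring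

lemma hasSum_tracePair (hρ : ρ.HasFiniteMoments) {u w : Occupation μ → FockCore μ}
    (hu : Tempered u) (hw : Tempered w)
    (α : μ → ℂ) : HasSum (fun x : Occupation μ × Occupation μ =>
      ρ.elem x.1 x.2 * matElem α (u x.2) (w x.1)) (tracePair ρ u w α) := by
  obtain ⟨b, hb, h⟩ := exists_summable_bound hρ hu hw
  exact (Summable.of_norm_bounded hb (h α)).hasSum

lemma exists_norm_tracePair_le (hρ : ρ.HasFiniteMoments) {u w : Occupation μ → FockCore μ}
    (hu : Tempered u) (hw : Tempered w) : ∃ C, ∀ α, ‖tracePair ρ u w α‖ ≤ C := by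
  obtain ⟨b, hb, h⟩ := exists_summable_bound hρ hu hw
  exact ⟨∑' x, b x, fun α => tsum_of_norm_bounded hb.hasSum (h α)⟩

lemma mul_tracePair (hρ : ρ.HasFiniteMoments) {u w : Occupation μ → FockCore μ}
    (hu : Tempered u) (hw : Tempered w)
    (α : μ → ℂ) (n : μ) : α n * tracePair ρ u w α =
      tracePair ρ (fun k => creation n (u k)) w α -
        tracePair ρ u (fun k => annihilation n (w k)) α := by
  refine ((hasSum_tracePair hρ hu hw α).mul_left (α n)).unique ?_
  have h : (fun x : Occupation μ × Occupation μ =>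
      α n * (ρ.elem x.1 x.2 * matElem α (u x.2) (w x.1))) = fun x =>
      ρ.elem x.1 x.2 * matElem α (creation n (u x.2)) (w x.1) -
        ρ.elem x.1 x.2 * matElem α (u x.2) (annihilation n (w x.1)) := by
    funext x
    rw [← mul_sub, ← mul_matElem]; ring
  rw [h]
  exact (hasSum_tracePair hρ (hu.creation n) hw α).sub
    (hasSum_tracePair hρ hu (hw.annihilation n) α)

lemma hasFDerivAt_tracePair (hρ : ρ.HasFiniteMoments) {u w : Occupation μ → FockCore μ}
    (hu : Tempered u) (hw : Tempered w) (α : AmpSpace μ) :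
    HasFDerivAt (fun α : AmpSpace μ => tracePair ρ u w α.ofLp)
      (ampForm
        (fun n => (1 / 2 : ℂ) * (tracePair ρ (fun k => annihilation n (u k)) w α.ofLp +
          tracePair ρ u (fun k => creation n (w k)) α.ofLp))
        (fun n => (-(1 / 2 : ℂ)) * (tracePair ρ (fun k => creation n (u k)) w α.ofLp +
          tracePair ρ u (fun k => annihilation n (w k)) α.ofLp))) α := by
  choose b1 hb1 h1 using fun n => exists_summable_bound hρ (hu.annihilation n) hw
  choose b2 hb2 h2 using fun n => exists_summable_bound hρ hu (hw.creation n)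
  choose b3 hb3 h3 using fun n => exists_summable_bound hρ (hu.creation n) hw
  choose b4 hb4 h4 using fun n => exists_summable_bound hρ hu (hw.annihilation n)
  let f' : Occupation μ × Occupation μ → AmpSpace μ → (AmpSpace μ →L[ℝ] ℂ) := fun x β => ampForm
    (fun n => (1 / 2 : ℂ) *
      (ρ.elem x.1 x.2 * matElem β.ofLp (annihilation n (u x.2)) (w x.1) +
        ρ.elem x.1 x.2 * matElem β.ofLp (u x.2) (creation n (w x.1))))
    (fun n => (-(1 / 2 : ℂ)) *
      (ρ.elem x.1 x.2 * matElem β.ofLp (creation n (u x.2)) (w x.1) +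
        ρ.elem x.1 x.2 * matElem β.ofLp (u x.2) (annihilation n (w x.1))))
  have hb : Summable fun x => ∑ n, (1 / 2 * (b1 n x + b2 n x) + 1 / 2 * (b3 n x + b4 n x)) :=
    summable_sum fun n _ => (((hb1 n).add (hb2 n)).mul_left _).add
      (((hb3 n).add (hb4 n)).mul_left _)
  have hf : ∀ x (β : AmpSpace μ), HasFDerivAt
      (fun β : AmpSpace μ => ρ.elem x.1 x.2 * matElem β.ofLp (u x.2) (w x.1)) (f' x β) β := by
    intro x β
    refine ((hasFDerivAt_matElem (u x.2) (w x.1) β).const_mul _).congr_fderiv ?_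
    refine ContinuousLinearMap.ext fun v => ?_
    simp only [f', _root_.smul_apply, ampForm_apply, smul_eq_mul, Finset.mul_sum]
    exact Finset.sum_congr rfl fun n _ => by ring
  have hf' : ∀ x β, ‖f' x β‖ ≤
      ∑ n, (1 / 2 * (b1 n x + b2 n x) + 1 / 2 * (b3 n x + b4 n x)) := by
    intro x β
    refine (norm_ampForm_le _ _).trans (Finset.sum_le_sum fun n _ => ?_)
    have hhalf : ‖(1 / 2 : ℂ)‖ = 1 / 2 := by norm_num
    rw [norm_mul, norm_mul, norm_neg, hhalf]
    refine add_le_add ?_ ?_ <;> refine mul_le_mul_of_nonneg_left ?_ (by norm_num)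
    · exact (norm_add_le _ _).trans (add_le_add (h1 n _ x) (h2 n _ x))
    · exact (norm_add_le _ _).trans (add_le_add (h3 n _ x) (h4 n _ x))
  have main := hasFDerivAt_tsum hb hf hf' (hasSum_tracePair hρ hu hw (0 : AmpSpace μ).ofLp).summable
    α
  refine main.congr_fderiv (HasSum.tsum_eq ?_)
  exact hasSum_ampForm
    (fun n => ((hasSum_tracePair hρ (hu.annihilation n) hw _).add
      (hasSum_tracePair hρ hu (hw.creation n) _)).mul_left _)
    (fun n => ((hasSum_tracePair hρ (hu.creation n) hw _).add
      (hasSum_tracePair hρ hu (hw.annihilation n) _)).mul_left _)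

end TracePair

section Decay

variable {E F G : Type*} [NormedAddCommGroup E] [NormedSpace ℝ E] [NormedAddCommGroup F]
  [NormedSpace ℝ F] [NormedAddCommGroup G] [NormedSpace ℝ G]

/-- `f` is `n` times continuously differentiable and its `n`-th derivative is bounded by a multiple
of `‖x‖ ^ (-k)`. -/
def DecayOrder (n k : ℕ) (f : E → F) : Prop :=
  ContDiff ℝ n f ∧ ∃ C : ℝ, ∀ x, ‖x‖ ^ k * ‖iteratedFDeriv ℝ n f x‖ ≤ C

lemma decayOrder_zero_fun (n k : ℕ) : DecayOrder n k fun _ : E => (0 : F) :=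
  ⟨contDiff_const, 0, fun x => by simp⟩

lemma DecayOrder.add {n k : ℕ} {f g : E → F} (hf : DecayOrder n k f) (hg : DecayOrder n k g) :
    DecayOrder n k fun x => f x + g x := by
  obtain ⟨hf, C, hC⟩ := hf
  obtain ⟨hg, C', hC'⟩ := hg
  refine ⟨hf.add hg, C + C', fun x => ?_⟩
  have h : iteratedFDeriv ℝ n (fun x => f x + g x) x =
      iteratedFDeriv ℝ n f x + iteratedFDeriv ℝ n g x :=
    iteratedFDeriv_add_apply hf.contDiffAt hg.contDiffAt
  rw [h]
  calc _ ≤ ‖x‖ ^ k * (‖iteratedFDeriv ℝ n f x‖ + ‖iteratedFDeriv ℝ n g x‖) := by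
        gcongr; exact norm_add_le _ _
    _ ≤ C + C' := by rw [mul_add]; exact add_le_add (hC x) (hC' x)

lemma DecayOrder.comp_left {n k : ℕ} {f : E → F} (hf : DecayOrder n k f) (L : F →L[ℝ] G) :
    DecayOrder n k fun x => L (f x) := by
  obtain ⟨hf, C, hC⟩ := hf
  refine ⟨L.contDiff.comp hf, ‖L‖ * C, fun x => ?_⟩
  have h := L.norm_iteratedFDeriv_comp_left (hf.contDiffAt (x := x)) le_rfl
  calc _ ≤ ‖x‖ ^ k * (‖L‖ * ‖iteratedFDeriv ℝ n f x‖) := by gcongr; exact h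
    _ = ‖L‖ * (‖x‖ ^ k * ‖iteratedFDeriv ℝ n f x‖) := by ring
    _ ≤ _ := by gcongr; exact hC x

lemma DecayOrder.sum {ι : Type*} (s : Finset ι) {n k : ℕ} {f : ι → E → F}
    (hf : ∀ i, DecayOrder n k (f i)) : DecayOrder n k fun x => ∑ i ∈ s, f i x := by
  classical
  induction s using Finset.induction_on with
  | empty => simpa using decayOrder_zero_fun n k
  | insert i s hi ih => simpa only [Finset.sum_insert hi] using (hf i).add ih

lemma DecayOrder.mul_const_smul {n k : ℕ} {f : E → ℂ} (hf : DecayOrder n k f) (c : ℂ)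
    (L : E →L[ℝ] ℂ) : DecayOrder n k fun x => (c * f x) • L :=
  hf.comp_left (((ContinuousLinearMap.id ℝ ℂ).smulRight L).comp (ContinuousLinearMap.mul ℝ ℂ c))

end Decay

section Schwartz

variable {μ : Type*} [Fintype μ] {ρ : DensityOperator μ}

lemma exists_pow_mul_tracePair_le (hρ : ρ.HasFiniteMoments) (k : ℕ)
    {u w : Occupation μ → FockCore μ} (hu : Tempered u) (hw : Tempered w) :
    ∃ C, ∀ α : AmpSpace μ, ‖α‖ ^ k * ‖tracePair ρ u w α.ofLp‖ ≤ C := by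
  induction k generalizing u w with
  | zero =>
    obtain ⟨C, hC⟩ := exists_norm_tracePair_le hρ hu hw
    exact ⟨C, fun α => by simpa using hC α.ofLp⟩
  | succ k ih =>
    choose C hC using fun n => ih (hu.creation n) hw
    choose C' hC' using fun n => ih hu (hw.annihilation n)
    refine ⟨∑ n, (C n + C' n), fun α => ?_⟩
    have h1 : ‖α‖ ≤ ∑ n, ‖α n‖ := by
      classical
      calc ‖α‖ = ‖∑ n, PiLp.single 2 n (α n)‖ := by
            congr 1
            ext n
            simp [WithLp.ofLp_sum, Finset.sum_apply, Pi.single_apply]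
        _ ≤ ∑ n, ‖PiLp.single (β := fun _ => ℂ) 2 n (α n)‖ := norm_sum_le _ _
        _ = _ := by simp
    calc ‖α‖ ^ (k + 1) * ‖tracePair ρ u w α.ofLp‖
        = ‖α‖ * (‖α‖ ^ k * ‖tracePair ρ u w α.ofLp‖) := by ring
      _ ≤ (∑ n, ‖α n‖) * (‖α‖ ^ k * ‖tracePair ρ u w α.ofLp‖) := by gcongr
      _ = ∑ n, ‖α‖ ^ k * ‖α n * tracePair ρ u w α.ofLp‖ := by
        rw [Finset.sum_mul]
        exact Finset.sum_congr rfl fun n _ => by rw [norm_mul]; ring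
      _ ≤ _ := by
        refine Finset.sum_le_sum fun n _ => ?_
        rw [mul_tracePair hρ hu hw]
        calc _ ≤ ‖α‖ ^ k * (_ + _) := by gcongr; exact norm_sub_le _ _
          _ ≤ _ := by rw [mul_add]; exact add_le_add (hC n α) (hC' n α)

/-- Derivatives and products with amplitudes are again of the form `tracePair`, and all functions
of this form are bounded. -/
lemma decayOrder_tracePair (hρ : ρ.HasFiniteMoments) (n k : ℕ) {u w : Occupation μ → FockCore μ}
    (hu : Tempered u) (hw : Tempered w) :
    DecayOrder n k fun α : AmpSpace μ => tracePair ρ u w α.ofLp := by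
  induction n generalizing u w with
  | zero =>
    refine ⟨?_, ?_⟩
    · rw [Nat.cast_zero, contDiff_zero, continuous_iff_continuousAt]
      exact fun α => (hasFDerivAt_tracePair hρ hu hw α).continuousAt
    · obtain ⟨C, hC⟩ := exists_pow_mul_tracePair_le hρ k hu hw
      exact ⟨C, fun α => by simpa using hC α⟩
  | succ n ih =>
    have h : DecayOrder n k fun α : AmpSpace μ => ampForm
        (fun n => (1 / 2 : ℂ) * (tracePair ρ (fun k => annihilation n (u k)) w α.ofLp +
          tracePair ρ u (fun k => creation n (w k)) α.ofLp))
        (fun n => (-(1 / 2 : ℂ)) * (tracePair ρ (fun k => creation n (u k)) w α.ofLp +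
          tracePair ρ u (fun k => annihilation n (w k)) α.ofLp)) :=
      DecayOrder.sum _ fun m =>
        (((ih (hu.annihilation m) hw).add (ih hu (hw.creation m))).mul_const_smul _ _).add
        (((ih (hu.creation m) hw).add (ih hu (hw.annihilation m))).mul_const_smul _ _)
    obtain ⟨h1, C, hC⟩ := h
    refine ⟨?_, C, fun α => ?_⟩
    · rw [Nat.cast_succ]
      exact contDiff_succ_iff_hasFDerivAt.2 ⟨_, h1, hasFDerivAt_tracePair hρ hu hw⟩
    · rw [← norm_iteratedFDeriv_fderiv,
        funext fun α => (hasFDerivAt_tracePair hρ hu hw α).fderiv]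
      exact hC α

/-- `tracePair` as a Schwartz function of the amplitudes. -/
def schwartzPair (hρ : ρ.HasFiniteMoments) {u w : Occupation μ → FockCore μ}
    (hu : Tempered u) (hw : Tempered w) :
    SchwartzMap (AmpSpace μ) ℂ where
  toFun α := tracePair ρ u w α.ofLp
  smooth' := contDiff_infty.2 fun n => (decayOrder_tracePair hρ n 0 hu hw).1
  decay' k n := (decayOrder_tracePair hρ n k hu hw).2

end Schwartz

/-! ### Moments as derivatives of the characteristic function -/

section Moments

open scoped LineDeriv FourierTransform SchwartzMap

variable {μ : Type*} [Fintype μ]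

/-- The general complex-linear combination of creation and annihilation operators, as a
displacement generator with complexified amplitudes `c.1 + i c.2`. -/
def linOp (c : (μ → ℂ) × (μ → ℂ)) : Module.End ℂ (FockCore μ) := gen c.1 + Complex.I • gen c.2

/-- The formal adjoint of `linOp c`. -/
def linOpAdj (c : (μ → ℂ) × (μ → ℂ)) : Module.End ℂ (FockCore μ) :=
  gen (-c.1) + Complex.I • gen c.2

lemma linOp_sum {ι : Type*} (s : Finset ι) (c : ι → (μ → ℂ) × (μ → ℂ)) :
    linOp (∑ i ∈ s, c i) = ∑ i ∈ s, linOp (c i) := by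
  simp only [linOp, Prod.fst_sum, Prod.snd_sum, gen_sum, Finset.sum_add_distrib, Finset.smul_sum]

lemma inner_toFock_linOpAdj_pow (c : (μ → ℂ) × (μ → ℂ)) (m : ℕ) (u w : FockCore μ) :
    ⟪toFock μ ((linOpAdj c ^ m) u), toFock μ w⟫_ℂ =
      ⟪toFock μ u, toFock μ ((linOp c ^ m) w)⟫_ℂ := by
  have h : ∀ u w, ⟪toFock μ (linOpAdj c u), toFock μ w⟫_ℂ =
      ⟪toFock μ u, toFock μ (linOp c w)⟫_ℂ := by
    intro u w
    simp only [linOpAdj, linOp, LinearMap.add_apply, LinearMap.smul_apply, map_add, map_smul,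
      inner_add_left, inner_add_right, inner_smul_left, inner_smul_right, inner_toFock_gen,
      gen_neg_apply, map_neg, inner_neg_left, Complex.conj_I]
    ring
  induction m generalizing w with
  | zero => simp
  | succ m ih => rw [pow_succ', Module.End.mul_apply, h, ih, pow_succ, Module.End.mul_apply]

lemma Tempered.gen {u : Occupation μ → FockCore μ} (hu : Tempered u) (v : μ → ℂ) :
    Tempered fun k => gen v (u k) := by
  have h := Tempered.sum Finset.univ (u := fun n k => v n • FuncWigner.creation n (u k) +
    (-conj (v n)) • FuncWigner.annihilation n (u k)) fun n =>
      ((hu.creation n).smul (v n)).add ((hu.annihilation n).smul (-conj (v n)))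
  simpa only [gen_apply, sub_eq_add_neg, neg_smul] using h

lemma Tempered.linOp {u : Occupation μ → FockCore μ} (hu : Tempered u)
    (c : (μ → ℂ) × (μ → ℂ)) : Tempered fun k => linOp c (u k) :=
  (hu.gen c.1).add ((hu.gen c.2).smul Complex.I)

lemma Tempered.linOpAdj {u : Occupation μ → FockCore μ} (hu : Tempered u)
    (c : (μ → ℂ) × (μ → ℂ)) : Tempered fun k => linOpAdj c (u k) :=
  (hu.gen (-c.1)).add ((hu.gen c.2).smul Complex.I)

lemma Tempered.linOp_pow {u : Occupation μ → FockCore μ} (hu : Tempered u)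
    (c : (μ → ℂ) × (μ → ℂ)) (m : ℕ) : Tempered fun k => (FuncWigner.linOp c ^ m) (u k) := by
  induction m with
  | zero => simpa using hu
  | succ m ih => simpa only [pow_succ', Module.End.mul_apply] using ih.linOp c

lemma Tempered.linOpAdj_pow {u : Occupation μ → FockCore μ} (hu : Tempered u)
    (c : (μ → ℂ) × (μ → ℂ)) (m : ℕ) : Tempered fun k => (FuncWigner.linOpAdj c ^ m) (u k) := by
  induction m with
  | zero => simpa using hu
  | succ m ih => simpa only [pow_succ', Module.End.mul_apply] using ih.linOpAdj c

lemma matElem_gen_left (α v : μ → ℂ) (u w : FockCore μ) : matElem α (gen v u) w =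
    ∑ n, (conj (v n) * matElem α (creation n u) w - v n * matElem α (annihilation n u) w) := by
  simp only [matElem, gen_apply, map_sum, map_sub, map_smul, sum_inner, inner_sub_left,
    inner_smul_left, Complex.conj_conj]

lemma matElem_gen_right (α v : μ → ℂ) (u w : FockCore μ) : matElem α u (gen v w) =
    ∑ n, (v n * matElem α u (creation n w) - conj (v n) * matElem α u (annihilation n w)) := by
  simp only [matElem, gen_apply, map_sum, map_sub, map_smul, inner_sum, inner_sub_right,
    inner_smul_right]

variable {ρ : DensityOperator μ}

lemma schwartzPair_apply (hρ : ρ.HasFiniteMoments) {u w : Occupation μ → FockCore μ}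
    (hu : Tempered u) (hw : Tempered w) (α : AmpSpace μ) :
    schwartzPair hρ hu hw α = tracePair ρ u w α.ofLp := rfl

/-- The complex directional derivative `∂_{c.1} + i ∂_{c.2}` on Schwartz functions. -/
def complexDeriv (c : (μ → ℂ) × (μ → ℂ)) : Module.End ℂ (𝓢(AmpSpace μ, ℂ)) :=
  (LineDeriv.lineDerivOpCLM ℂ 𝓢(AmpSpace μ, ℂ) (WithLp.toLp 2 c.1)).toLinearMap +
    Complex.I • (LineDeriv.lineDerivOpCLM ℂ 𝓢(AmpSpace μ, ℂ) (WithLp.toLp 2 c.2)).toLinearMap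

lemma complexDeriv_apply (c : (μ → ℂ) × (μ → ℂ)) (f : 𝓢(AmpSpace μ, ℂ)) :
    complexDeriv c f = ∂_{(WithLp.toLp 2 c.1 : AmpSpace μ)} f +
      Complex.I • ∂_{(WithLp.toLp 2 c.2 : AmpSpace μ)} f := rfl

lemma complexDeriv_schwartzPair (hρ : ρ.HasFiniteMoments) (c : (μ → ℂ) × (μ → ℂ))
    {u w : Occupation μ → FockCore μ} (hu : Tempered u) (hw : Tempered w) :
    complexDeriv c (schwartzPair hρ hu hw) = (1 / 2 : ℂ) •
      (schwartzPair hρ (hu.linOpAdj c) hw + schwartzPair hρ hu (hw.linOp c)) := by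
  ext α
  have hd := (hasFDerivAt_tracePair hρ hu hw α).fderiv
  have hl : ∀ v : AmpSpace μ, (∂_{v} (schwartzPair hρ hu hw)) α =
      ampForm
        (fun n => (1 / 2 : ℂ) * (tracePair ρ (fun k => annihilation n (u k)) w α.ofLp +
          tracePair ρ u (fun k => creation n (w k)) α.ofLp))
        (fun n => (-(1 / 2 : ℂ)) * (tracePair ρ (fun k => creation n (u k)) w α.ofLp +
          tracePair ρ u (fun k => annihilation n (w k)) α.ofLp)) v := by
    intro v
    rw [SchwartzMap.lineDerivOp_apply_eq_fderiv, ← hd]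
    rfl
  have hs : ∀ v : AmpSpace μ, HasSum _ ((∂_{v} (schwartzPair hρ hu hw)) α) := fun v => by
    rw [hl, ampForm_apply]
    exact hasSum_sum fun n _ =>
      ((((hasSum_tracePair hρ (hu.annihilation n) hw α.ofLp).add
        (hasSum_tracePair hρ hu (hw.creation n) α.ofLp)).mul_left (1 / 2)).mul_right (v n)).add
      ((((hasSum_tracePair hρ (hu.creation n) hw α.ofLp).add
        (hasSum_tracePair hρ hu (hw.annihilation n) α.ofLp)).mul_left (-(1 / 2))).mul_right
          (conj (v n)))
  have h1 := (hs (WithLp.toLp 2 c.1)).add ((hs (WithLp.toLp 2 c.2)).mul_left Complex.I)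
  have h2 := ((hasSum_tracePair hρ (hu.linOpAdj c) hw α.ofLp).add
    (hasSum_tracePair hρ hu (hw.linOp c) α.ofLp)).mul_left (1 / 2)
  refine h1.unique ?_
  refine Eq.mp ?_ h2
  congr 1
  funext x
  simp only [linOp, linOpAdj, LinearMap.add_apply, LinearMap.smul_apply, matElem_add_left,
    matElem_add_right, matElem_smul_left, matElem_smul_right, matElem_gen_left,
    matElem_gen_right, Pi.neg_apply, map_neg, Complex.conj_I, Finset.mul_sum,
    ← Finset.sum_add_distrib]
  exact Finset.sum_congr rfl fun n _ => by ring

lemma fourier_complexDeriv (c : (μ → ℂ) × (μ → ℂ)) (f : 𝓢(AmpSpace μ, ℂ)) (ξ : AmpSpace μ) :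
    𝓕 (complexDeriv c f) ξ = 2 * Real.pi * Complex.I *
      (⟪ξ, WithLp.toLp 2 c.1⟫_ℝ + Complex.I * ⟪ξ, WithLp.toLp 2 c.2⟫_ℝ) * 𝓕 f ξ := by
  have h : ∀ v : AmpSpace μ, 𝓕 (∂_{v} f) ξ = 2 * Real.pi * Complex.I * ⟪ξ, v⟫_ℝ * 𝓕 f ξ := by
    intro v
    have hg : Function.HasTemperateGrowth fun x : AmpSpace μ => ⟪x, v⟫_ℝ := by fun_prop
    rw [SchwartzMap.fourier_lineDerivOp_eq, _root_.smul_apply,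
      SchwartzMap.smulLeftCLM_apply_apply hg]
    simp [mul_assoc]
  rw [complexDeriv_apply, FourierTransform.fourier_add, FourierTransform.fourier_smul,
    _root_.add_apply, _root_.smul_apply, h, h, smul_eq_mul]
  ring

/-- The symbol of `complexDeriv c` under the Fourier transform. -/
def symbol (c : (μ → ℂ) × (μ → ℂ)) (ξ : AmpSpace μ) : ℂ :=
  2 * Real.pi * Complex.I * (⟪ξ, WithLp.toLp 2 c.1⟫_ℝ + Complex.I * ⟪ξ, WithLp.toLp 2 c.2⟫_ℝ)

lemma symbol_sum {ι : Type*} (s : Finset ι) (c : ι → (μ → ℂ) × (μ → ℂ)) (ξ : AmpSpace μ) :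
    symbol (∑ i ∈ s, c i) ξ = ∑ i ∈ s, symbol (c i) ξ := by
  simp only [symbol, Prod.fst_sum, Prod.snd_sum, WithLp.toLp_sum, inner_sum, Complex.ofReal_sum,
    ← Finset.mul_sum, Finset.sum_add_distrib]

lemma fourier_complexDeriv_pow (c : (μ → ℂ) × (μ → ℂ)) (N : ℕ) (f : 𝓢(AmpSpace μ, ℂ))
    (ξ : AmpSpace μ) : 𝓕 ((complexDeriv c ^ N) f) ξ = symbol c ξ ^ N * 𝓕 f ξ := by
  induction N with
  | zero => simp
  | succ N ih =>
    rw [pow_succ', Module.End.mul_apply, fourier_complexDeriv, ih, symbol]; ring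

lemma integral_fourier_eq (f : 𝓢(AmpSpace μ, ℂ)) : ∫ ξ, 𝓕 f ξ = f 0 := by
  have h : 𝓕⁻ (𝓕 f) 0 = f 0 := by rw [FourierTransform.fourierInv_fourier_eq]
  rw [← h, SchwartzMap.fourierInv_coe, Real.fourierInv_eq]
  simp

/-- The characteristic function `α ↦ Tr (ρ D(α))`, as a Schwartz function. -/
def charSchwartz (hρ : ρ.HasFiniteMoments) : 𝓢(AmpSpace μ, ℂ) :=
  schwartzPair hρ tempered_single tempered_single

lemma hasSum_diagonal_mul_expOperator (hρ : ρ.HasFiniteMoments) (α : AmpSpace μ) :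
    HasSum (diagonal (ρ.op * expOperator (gen α.ofLp))) (charSchwartz hρ α) := by
  refine (hasSum_tracePair hρ tempered_single tempered_single α.ofLp).prod_fiberwise fun k => ?_
  have h := ρ.hasSum_elem_mul_inner k (expOperator (gen α.ofLp) (numberState k))
  have e : ∀ l : Occupation μ, (numberState l : FockSpace μ) = toFock μ (Finsupp.single l 1) :=
    fun l => by rw [toFock_single, one_smul]
  simp only [e k, expOperator_gen_toFock] at h
  rw [diagonal, mul_apply_eq_comp, e k, expOperator_gen_toFock]
  convert h using 2 with l
  rw [matElem, e l]

lemma hasSum_diagonalMul (hρ : ρ.HasFiniteMoments) (X : Module.End ℂ (FockCore μ))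
    (hX : Tempered fun k => X (Finsupp.single k 1)) :
    HasSum (ρ.diagonalMul X)
      (tracePair ρ (fun k => Finsupp.single k 1) (fun k => X (Finsupp.single k 1)) 0) := by
  refine (hasSum_tracePair hρ tempered_single hX 0).prod_fiberwise fun k => ?_
  convert ρ.hasSum_elem_mul_inner k (toFock μ (X (Finsupp.single k 1))) using 2 with l
  · rw [matElem, expLin_zero, toFock_single, one_smul]
  · rfl

/-- Each differentiation of `Tr (ρ X ^ m D(α) X ^ n)`, where `X = linOp c`, raises `m` or `n` by
one; at the origin `D(0) = 1`, so only `N + m + n` matters. -/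
lemma complexDeriv_pow_schwartzPair_zero (hρ : ρ.HasFiniteMoments) (c : (μ → ℂ) × (μ → ℂ))
    (N m n : ℕ) :
    ((complexDeriv c ^ N) (schwartzPair hρ (tempered_single.linOpAdj_pow c m)
      (tempered_single.linOp_pow c n))) 0 =
      tracePair ρ (fun k => Finsupp.single k 1)
        (fun k => (linOp c ^ (N + m + n)) (Finsupp.single k 1)) 0 := by
  induction N generalizing m n with
  | zero =>
    rw [pow_zero, Module.End.one_apply, schwartzPair_apply, WithLp.ofLp_zero]
    refine tsum_congr fun x => ?_
    rw [matElem, matElem, expLin_zero, expLin_zero, inner_toFock_linOpAdj_pow,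
      ← Module.End.mul_apply, ← pow_add, zero_add]
  | succ N ih =>
    have h1 : schwartzPair hρ ((tempered_single.linOpAdj_pow c m).linOpAdj c)
        (tempered_single.linOp_pow c n) = schwartzPair hρ
        (tempered_single.linOpAdj_pow c (m + 1)) (tempered_single.linOp_pow c n) := by
      congr 1; funext k; rw [pow_succ', Module.End.mul_apply]
    have h2 : schwartzPair hρ (tempered_single.linOpAdj_pow c m)
        ((tempered_single.linOp_pow c n).linOp c) = schwartzPair hρ
        (tempered_single.linOpAdj_pow c m) (tempered_single.linOp_pow c (n + 1)) := by
      congr 1; funext k; rw [pow_succ', Module.End.mul_apply]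
    rw [pow_succ, Module.End.mul_apply, complexDeriv_schwartzPair, h1, h2, map_smul, map_add,
      _root_.smul_apply, _root_.add_apply, ih, ih,
      show N + (m + 1) + n = N + 1 + m + n by ring, show N + m + (n + 1) = N + 1 + m + n by ring,
      smul_eq_mul]
    ring

lemma integrable_symbol_pow_mul (hρ : ρ.HasFiniteMoments) (c : (μ → ℂ) × (μ → ℂ)) (N : ℕ) :
    Integrable fun ξ : AmpSpace μ => symbol c ξ ^ N * 𝓕 (charSchwartz hρ) ξ := by
  have h := (𝓕 ((complexDeriv c ^ N) (charSchwartz hρ))).integrable (μ := volume)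
  exact h.congr (Filter.Eventually.of_forall fun ξ => fourier_complexDeriv_pow c N _ ξ)

/-- The moments of powers of a linear combination of creation and annihilation operators. -/
lemma hasSum_diagonalMul_linOp_pow (hρ : ρ.HasFiniteMoments) (c : (μ → ℂ) × (μ → ℂ)) (N : ℕ) :
    HasSum (ρ.diagonalMul (linOp c ^ N))
      (∫ ξ : AmpSpace μ, symbol c ξ ^ N * 𝓕 (charSchwartz hρ) ξ) := by
  have h := hasSum_diagonalMul hρ (linOp c ^ N) (tempered_single.linOp_pow c N)
  have h2 := complexDeriv_pow_schwartzPair_zero hρ c N 0 0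
  have h3 : schwartzPair hρ (tempered_single.linOpAdj_pow c 0) (tempered_single.linOp_pow c 0) =
      charSchwartz hρ := by
    simp only [charSchwartz, pow_zero, Module.End.one_apply]
  rw [h3, ← integral_fourier_eq, add_zero, add_zero] at h2
  rw [← h2] at h
  simpa only [fourier_complexDeriv_pow] using h

end Moments

/-! ### Polarization of symmetrically ordered products -/

/-- The noncommutative polarization identity: by inclusion and exclusion over the complements `T`
of the sets of factors that occur, only the products that contain every factor survive. -/
lemma sum_perm_prod_eq_sum_powers {R : Type*} [Semiring R] [Algebra ℂ R] {n : ℕ} (X : Fin n → R) :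
    ∑ σ : Equiv.Perm (Fin n), (List.ofFn fun i => X (σ i)).prod =
      ∑ T : Finset (Fin n), ((-1 : ℂ) ^ T.card) • (∑ i ∈ Tᶜ, X i) ^ n := by
  have hpow : ∀ T : Finset (Fin n), (∑ i ∈ Tᶜ, X i) ^ n =
      ∑ f : Fin n → Fin n, if T ⊆ (Finset.univ.image f)ᶜ then (List.ofFn fun i => X (f i)).prod
        else 0 := by
    intro T
    have h := (MultilinearMap.mkPiAlgebraFin ℂ n R).map_sum_finset (fun _ => X) fun _ => Tᶜ
    simp only [MultilinearMap.mkPiAlgebraFin_apply, List.ofFn_const, List.prod_replicate] at h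
    rw [h, ← Finset.sum_filter]
    refine Finset.sum_congr ?_ fun _ _ => rfl
    ext f
    simp only [Fintype.mem_piFinset, Finset.mem_compl, Finset.mem_filter, Finset.mem_univ,
      true_and, Finset.subset_iff, Finset.mem_image, not_exists]
    exact ⟨fun h t ht i hi => h i (hi ▸ ht), fun h i hi => h hi i rfl⟩
  have hsum : ∀ f : Fin n → Fin n, ∑ T : Finset (Fin n),
      ((-1 : ℂ) ^ T.card) • (if T ⊆ (Finset.univ.image f)ᶜ then (List.ofFn fun i => X (f i)).prod
        else 0) = if Function.Bijective f then (List.ofFn fun i => X (f i)).prod else 0 := by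
    intro f
    have h1 : ∑ T ∈ ((Finset.univ.image f)ᶜ).powerset, (-1 : ℂ) ^ T.card =
        if (Finset.univ.image f)ᶜ = ∅ then 1 else 0 := by
      exact_mod_cast congrArg (Int.cast : ℤ → ℂ)
        (Finset.sum_powerset_neg_one_pow_card (x := (Finset.univ.image f)ᶜ))
    have h2 : (Finset.univ.image f)ᶜ = ∅ ↔ Function.Bijective f := by
      rw [Finset.compl_eq_empty_iff, ← Finite.surjective_iff_bijective, Finset.eq_univ_iff_forall]
      simp [Function.Surjective]
    simp only [smul_ite, smul_zero]
    rw [← Finset.sum_filter, ← Finset.sum_smul]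
    have h3 : Finset.univ.filter (fun T : Finset (Fin n) => T ⊆ (Finset.univ.image f)ᶜ) =
        ((Finset.univ.image f)ᶜ).powerset := by
      ext T; simp
    rw [h3, h1]
    simp only [h2, ite_smul, one_smul, zero_smul]
  simp only [hpow, Finset.smul_sum]
  rw [Finset.sum_comm]
  simp only [hsum]
  rw [← Finset.sum_filter]
  refine Finset.sum_bij (fun σ _ => ⇑σ) (fun σ _ => ?_) (fun σ _ τ _ h => ?_) (fun f hf => ?_)
    fun σ _ => rfl
  · exact Finset.mem_filter.2 ⟨Finset.mem_univ _, σ.bijective⟩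
  · exact DFunLike.coe_injective h
  · exact ⟨Equiv.ofBijective f (Finset.mem_filter.1 hf).2, Finset.mem_univ _, rfl⟩

section Moments

open scoped FourierTransform SchwartzMap

variable {μ : Type*} [Fintype μ] {ρ : DensityOperator μ}

/-- The expectation of a symmetrically ordered product is the phase-space average of the product
of the symbols of the factors. -/
theorem hasSum_diagonalMul_symProd (hρ : ρ.HasFiniteMoments)
    (cs : List ((μ → ℂ) × (μ → ℂ))) :
    (Integrable fun ξ : AmpSpace μ =>
      (cs.map fun c => symbol c ξ).prod * 𝓕 (charSchwartz hρ) ξ) ∧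
    HasSum (ρ.diagonalMul (symProd (cs.map linOp)))
      (∫ ξ : AmpSpace μ, (cs.map fun c => symbol c ξ).prod * 𝓕 (charSchwartz hρ) ξ) := by
  set l := cs.map (linOp (μ := μ)) with hl
  set n := l.length with hn
  have hlen : n = cs.length := by rw [hn, hl, List.length_map]
  set c : Fin n → (μ → ℂ) × (μ → ℂ) := fun i => cs.get (Fin.cast hlen i) with hc
  have hget : ∀ i : Fin n, l.get i = linOp (c i) := fun i => by simp [hl, hc]
  have hfac : (n.factorial : ℂ) ≠ 0 := by exact_mod_cast Nat.factorial_ne_zero n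
  have hprod : ∀ ξ : AmpSpace μ, (cs.map fun c => symbol c ξ).prod =
      (n.factorial : ℂ)⁻¹ * ∑ T : Finset (Fin n),
        (-1 : ℂ) ^ T.card * symbol (∑ i ∈ Tᶜ, c i) ξ ^ n := by
    intro ξ
    have h := sum_perm_prod_eq_sum_powers fun i => symbol (c i) ξ
    have h1 : ∀ σ : Equiv.Perm (Fin n), (List.ofFn fun i => symbol (c (σ i)) ξ).prod =
        (cs.map fun c => symbol c ξ).prod := by
      intro σ
      rw [List.prod_ofFn, Equiv.prod_comp σ fun i => symbol (c i) ξ, ← List.prod_ofFn]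
      congr 1
      refine List.ext_getElem (by simp [hlen]) fun i h1 h2 => ?_
      simp [hc]
    simp only [h1, ← symbol_sum, Finset.sum_const, Finset.card_univ, Fintype.card_perm,
      Fintype.card_fin, smul_eq_mul] at h
    rw [← h, nsmul_eq_mul, inv_mul_cancel_left₀ hfac]
  have hsym : symProd l = (n.factorial : ℂ)⁻¹ • ∑ T : Finset (Fin n),
      ((-1 : ℂ) ^ T.card) • linOp (∑ i ∈ Tᶜ, c i) ^ n := by
    rw [symProd]
    congr 1
    simp only [linOp_sum, ← hget]
    exact sum_perm_prod_eq_sum_powers fun i => l.get i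
  have hint : ∀ T : Finset (Fin n), Integrable fun ξ : AmpSpace μ =>
      (-1 : ℂ) ^ T.card * (symbol (∑ i ∈ Tᶜ, c i) ξ ^ n * 𝓕 (charSchwartz hρ) ξ) := fun T =>
    (integrable_symbol_pow_mul hρ _ n).const_mul _
  have heq : (fun ξ : AmpSpace μ => (cs.map fun c => symbol c ξ).prod * 𝓕 (charSchwartz hρ) ξ) =
      fun ξ => (n.factorial : ℂ)⁻¹ * ∑ T : Finset (Fin n),
        (-1 : ℂ) ^ T.card * (symbol (∑ i ∈ Tᶜ, c i) ξ ^ n * 𝓕 (charSchwartz hρ) ξ) := by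
    funext ξ
    rw [hprod, mul_assoc, Finset.sum_mul]
    congr 1
    exact Finset.sum_congr rfl fun T _ => by ring
  have hsumm := (hasSum_sum (s := Finset.univ) fun (T : Finset (Fin n)) _ =>
    (hasSum_diagonalMul_linOp_pow hρ (∑ i ∈ Tᶜ, c i) n).mul_left ((-1 : ℂ) ^ T.card)).mul_left
      (n.factorial : ℂ)⁻¹
  rw [heq]
  refine ⟨(integrable_finsetSum _ fun T _ => hint T).const_mul _, ?_⟩
  rw [integral_const_mul, integral_finsetSum _ fun T _ => hint T]
  simp only [integral_const_mul]
  have hdiag : ρ.diagonalMul (symProd l) = fun k => (n.factorial : ℂ)⁻¹ *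
      ∑ T : Finset (Fin n), (-1 : ℂ) ^ T.card *
        ρ.diagonalMul (linOp (∑ i ∈ Tᶜ, c i) ^ n) k := by
    funext k
    simp only [DensityOperator.diagonalMul, hsym, LinearMap.smul_apply, LinearMap.sum_apply,
      map_smul, map_sum, inner_smul_right, inner_sum]
  rw [hdiag]
  exact hsumm

end Moments

/-! ### Lebesgue measure on mode amplitudes -/

section Volume

lemma measurePreserving_piCurry {ι : Type*} [Fintype ι] {κ : ι → Type*} [∀ i, Fintype (κ i)]
    (X : Type*) [MeasureSpace X] [SigmaFinite (volume : Measure X)] :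
    MeasurePreserving (MeasurableEquiv.piCurry fun (i : ι) (_ : κ i) => X) volume volume := by
  refine MeasurePreserving.symm (MeasurableEquiv.piCurry fun (i : ι) (_ : κ i) => X).symm
    ⟨MeasurableEquiv.measurable _, ?_⟩
  refine (Measure.pi_eq fun s hs => ?_).symm
  rw [MeasurableEquiv.map_apply]
  have h : (MeasurableEquiv.piCurry fun (i : ι) (_ : κ i) => X).symm ⁻¹' Set.univ.pi s =
      Set.univ.pi fun i => Set.univ.pi fun k => s ⟨i, k⟩ := by
    ext f
    simp only [Set.mem_preimage, Set.mem_pi, Set.mem_univ, true_imp_iff, Sigma.forall]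
    rfl
  rw [h, volume_pi, Measure.pi_pi, Fintype.prod_sigma]
  exact Finset.prod_congr rfl fun i _ => by rw [volume_pi, Measure.pi_pi]

lemma measurePreserving_ofLp_ampSpace (μ : Type*) [Fintype μ] :
    MeasurePreserving (fun α : AmpSpace μ => α.ofLp) volume volume := by
  have h1 := (Pi.orthonormalBasis fun _ : μ => Complex.orthonormalBasisOneI).measurePreserving_repr
  have h2 := PiLp.volume_preserving_ofLp (Σ _ : μ, Fin 2)
  have h3 := measurePreserving_piCurry (κ := fun _ : μ => Fin 2) ℝ
  have h4 := volume_preserving_pi (fun _ : μ => Complex.volume_preserving_equiv_pi.symm)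
  have h : (fun α : AmpSpace μ => α.ofLp) =
      (fun (a : μ → Fin 2 → ℝ) i => Complex.measurableEquivPi.symm (a i)) ∘
        (MeasurableEquiv.piCurry fun (_ : μ) (_ : Fin 2) => ℝ) ∘ WithLp.ofLp ∘
          (Pi.orthonormalBasis fun _ : μ => Complex.orthonormalBasisOneI).repr := by
    funext α n
    exact (Complex.measurableEquivPi.symm_apply_apply (α n)).symm
  rw [h]
  exact h4.comp (h3.comp (h2.comp h1))

variable {C : ℕ} {B : Fin C → Type*} (M : ∀ j, Finset (B j))

/-- Amplitudes of all modes, as a tuple of amplitudes for each component. -/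
def ampEquiv : AmpSpace (Mode M) ≃ᵐ ((j : Fin C) → M j → ℂ) :=
  (MeasurableEquiv.toLp 2 (Mode M → ℂ)).symm.trans
    (MeasurableEquiv.piCurry fun (j : Fin C) (_ : M j) => ℂ)

lemma ampEquiv_apply (α : AmpSpace (Mode M)) (j : Fin C) (n : M j) :
    ampEquiv M α j n = α ⟨j, n⟩ := rfl

lemma measurePreserving_ampEquiv : MeasurePreserving (ampEquiv M) volume volume :=
  (measurePreserving_piCurry ℂ).comp (measurePreserving_ofLp_ampSpace (Mode M))

end Volume

section Phase

variable {μ : Type*} [Fintype μ]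

/-- Multiplication of all amplitudes by `i`. -/
def mulI (μ : Type*) [Fintype μ] : AmpSpace μ ≃ₗᵢ[ℝ] AmpSpace μ :=
  LinearIsometryEquiv.piLpCongrRight 2 fun _ => rotation ⟨Complex.I, by simp [Submonoid.unitSphere]⟩

lemma mulI_apply (α : AmpSpace μ) (n : μ) : mulI μ α n = Complex.I * α n := by
  simp only [mulI, LinearIsometryEquiv.piLpCongrRight_apply]
  exact rotation_apply _ _

/-- The conjugate variable `i β / π` of phase space: the phase `∑ n, (-α_n β_n^* + α_n^* β_n)` is
`-2 π i` times its real inner product with `α`. -/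
def phaseVar (β : AmpSpace μ) : AmpSpace μ := (Real.pi⁻¹ : ℝ) • mulI μ β

lemma phaseVar_apply (β : AmpSpace μ) (n : μ) :
    phaseVar β n = (Real.pi : ℂ)⁻¹ * (Complex.I * β n) := by
  simp [phaseVar, mulI_apply]

lemma finrank_ampSpace (μ : Type*) [Fintype μ] :
    Module.finrank ℝ (AmpSpace μ) = 2 * Fintype.card μ := by
  rw [Module.finrank_eq_card_basis
    (Pi.orthonormalBasis fun _ : μ => Complex.orthonormalBasisOneI).toBasis]
  simp [mul_comm]

lemma integral_comp_phaseVar (f : AmpSpace μ → ℂ) :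
    ∫ β, f (phaseVar β) = (Real.pi : ℂ) ^ (2 * Fintype.card μ) * ∫ ξ, f ξ := by
  have h := (mulI μ).measurePreserving.integral_comp (mulI μ).toHomeomorph.measurableEmbedding
    fun ξ => f ((Real.pi⁻¹ : ℝ) • ξ)
  rw [Measure.integral_comp_smul, finrank_ampSpace] at h
  rw [show (∫ β, f (phaseVar β)) = ∫ β, f ((Real.pi⁻¹ : ℝ) • mulI μ β) from rfl, h]
  rw [inv_pow, inv_inv, abs_of_pos (by positivity), Complex.real_smul]
  push_cast; rfl

lemma Integrable.comp_phaseVar {f : AmpSpace μ → ℂ} (hf : Integrable f) :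
    Integrable fun β => f (phaseVar β) := by
  have h := (integrable_comp_smul_iff volume f (R := Real.pi⁻¹) (by positivity)).2 hf
  exact ((mulI μ).measurePreserving.integrable_comp_emb
    (mulI μ).toHomeomorph.measurableEmbedding).2 h

lemma inner_ampSpace (α β : AmpSpace μ) :
    ((⟪α, β⟫_ℝ : ℝ) : ℂ) = ∑ n, (1 / 2 : ℂ) * (conj (α n) * β n + α n * conj (β n)) := by
  rw [PiLp.inner_apply, Complex.ofReal_sum]
  refine Finset.sum_congr rfl fun n _ => ?_
  rw [Complex.inner, Complex.re_eq_add_conj]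
  simp; ring

lemma phase_eq (α β : AmpSpace μ) :
    (∑ n, (-(α n) * conj (β n) + conj (α n) * β n)) =
      ((-2 * Real.pi * ⟪α, phaseVar β⟫_ℝ : ℝ) : ℂ) * Complex.I := by
  push_cast
  rw [inner_ampSpace, Finset.mul_sum, Finset.sum_mul]
  refine Finset.sum_congr rfl fun n _ => ?_
  have hpi : (Real.pi : ℂ) ≠ 0 := by exact_mod_cast Real.pi_ne_zero
  rw [phaseVar_apply]
  simp only [map_mul, map_inv₀, Complex.conj_ofReal, Complex.conj_I]
  field_simp
  ring_nf
  simp only [Complex.I_sq]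
  ring

/-- The complexified amplitudes of the operator `∑ n, (p_n a_n† + q_n a_n)`. -/
def ladderAmp (p q : μ → ℂ) : (μ → ℂ) × (μ → ℂ) :=
  (fun n => (p n - conj (q n)) / 2, fun n => (p n + conj (q n)) / (2 * Complex.I))

lemma linOp_ladderAmp (p q : μ → ℂ) :
    linOp (ladderAmp p q) = ∑ n, (p n • creation n + q n • annihilation n) := by
  refine LinearMap.ext fun u => ?_
  simp only [linOp, ladderAmp, LinearMap.add_apply, LinearMap.smul_apply, gen_apply,
    LinearMap.sum_apply, Finset.smul_sum, ← Finset.sum_add_distrib]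
  refine Finset.sum_congr rfl fun n _ => ?_
  have hI : Complex.I ≠ 0 := Complex.I_ne_zero
  have e1 : (p n - conj (q n)) / 2 + Complex.I * ((p n + conj (q n)) / (2 * Complex.I)) = p n := by
    field_simp; ring
  have e2 : -conj ((p n - conj (q n)) / 2) -
      Complex.I * conj ((p n + conj (q n)) / (2 * Complex.I)) = q n := by
    simp only [map_div₀, map_sub, map_add, map_mul, Complex.conj_conj, Complex.conj_I, map_ofNat]
    field_simp; ring
  rw [smul_sub, smul_smul, smul_smul, sub_add_sub_comm, ← add_smul, e1, sub_eq_add_neg, ← add_smul,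
    ← neg_smul, neg_add', e2]

/-- On phase space, annihilation and creation operators become the amplitudes and their
conjugates. -/
lemma symbol_ladderAmp (p q : μ → ℂ) (β : AmpSpace μ) :
    symbol (ladderAmp p q) (phaseVar β) = ∑ n, (p n * conj (β n) + q n * β n) := by
  rw [symbol, inner_ampSpace, inner_ampSpace, Finset.mul_sum, ← Finset.sum_add_distrib,
    Finset.mul_sum]
  refine Finset.sum_congr rfl fun n _ => ?_
  have hpi : (Real.pi : ℂ) ≠ 0 := by exact_mod_cast Real.pi_ne_zero
  have hI : Complex.I ≠ 0 := Complex.I_ne_zero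
  simp only [phaseVar_apply, ladderAmp, map_div₀, map_sub, map_add, map_mul, map_inv₀,
    Complex.conj_conj, Complex.conj_I, Complex.conj_ofReal, map_ofNat]
  field_simp
  ring_nf
  simp only [Complex.I_sq]
  ring

end Phase

/-! ### Field operators and functionals in terms of mode amplitudes -/

section Modes

variable {D : ℕ} {A : Set (Coord D)} {ι : Type*} (b : ModeBasis A ι) (M : Finset ι)

lemma compose_apply (α : M → ℂ) (x : Coord D) :
    (compose b M α).1 x = ∑ n, α n * b.φ n x := by
  change composeFun b M α x = _
  simp [composeFun, Fintype.linearCombination_apply]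

lemma exists_compose_eq (Ψ : Restricted b M) : ∃ α, compose b M α = Ψ :=
  (composeFun b M).surjective_rangeRestrict Ψ

lemma integrable_conj_mul (n m : ι) :
    Integrable (fun x => conj (b.φ n x) * b.φ m x) (volume.restrict A) :=
  (b.memLp n).star.integrable_mul (b.memLp m)

/-- Amplitudes are recovered from restricted functions by orthonormality. -/
lemma integral_conj_mode_mul_compose (α : M → ℂ) (m : M) :
    ∫ x in A, conj (b.φ m x) * (compose b M α).1 x = α m := by
  classical
  have h : ∀ x, conj (b.φ m x) * (compose b M α).1 x =
      ∑ n, α n * (conj (b.φ m x) * b.φ n x) := by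
    intro x
    rw [compose_apply, Finset.mul_sum]
    exact Finset.sum_congr rfl fun n _ => by ring
  simp_rw [h]
  rw [integral_finsetSum Finset.univ fun (n : M) _ =>
    (integrable_conj_mul b (m : ι) (n : ι)).const_mul (α n)]
  simp only [integral_const_mul, b.orthonormal]
  simp

lemma integral_compose_mul_conj_mode (α : M → ℂ) (m : M) :
    ∫ x in A, (compose b M α).1 x * conj (b.φ m x) = α m := by
  simp_rw [mul_comm _ (conj (b.φ _ _))]
  exact integral_conj_mode_mul_compose b M α m

lemma integral_conj_compose_mul_mode (α : M → ℂ) (m : M) :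
    ∫ x in A, conj ((compose b M α).1 x) * b.φ m x = conj (α m) := by
  rw [← integral_compose_mul_conj_mode b M α m, ← integral_conj]
  simp

lemma displacementFunctional_compose (α β : M → ℂ) :
    displacementFunctional A (compose b M α).1 (compose b M β).1 =
      Complex.exp (∑ n, (-(α n) * conj (β n) + conj (α n) * β n)) := by
  have hm : MemLp (compose b M α).1 2 (volume.restrict A) := by
    have h : MemLp (∑ n : M, α n • b.φ n) 2 (volume.restrict A) :=
      memLp_finsetSum' _ fun n _ => (b.memLp n).const_smul (α n)
    have e : (compose b M α).1 = ∑ n : M, α n • b.φ n := by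
      funext x; rw [compose_apply]; simp
    rwa [e]
  have h1 : ∀ n : M, Integrable (fun x => (compose b M α).1 x * conj (b.φ n x))
      (volume.restrict A) := fun n => hm.integrable_mul (b.memLp n).star
  have h2 : ∀ n : M, Integrable (fun x => conj ((compose b M α).1 x) * b.φ n x)
      (volume.restrict A) := fun n => hm.star.integrable_mul (b.memLp n)
  have h : ∀ x, -((compose b M α).1 x) * conj ((compose b M β).1 x) +
      conj ((compose b M α).1 x) * (compose b M β).1 x =
      ∑ n, (-(conj (β n)) * ((compose b M α).1 x * conj (b.φ n x)) +
        β n * (conj ((compose b M α).1 x) * b.φ n x)) := by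
    intro x
    rw [compose_apply b M β, map_sum, Finset.mul_sum, Finset.mul_sum, ← Finset.sum_add_distrib]
    exact Finset.sum_congr rfl fun n _ => by rw [map_mul]; ring
  have h3 : ∀ n ∈ Finset.univ, Integrable (fun x =>
      -(conj (β n)) * ((compose b M α).1 x * conj (b.φ n x)) +
        β n * (conj ((compose b M α).1 x) * b.φ n x)) (volume.restrict A) :=
    fun n _ => ((h1 n).const_mul _).add ((h2 n).const_mul _)
  rw [displacementFunctional]
  simp_rw [h]
  rw [integral_finsetSum _ h3]
  congr 1
  refine Finset.sum_congr rfl fun n _ => ?_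
  rw [integral_add ((h1 n).const_mul _) ((h2 n).const_mul _), integral_const_mul,
    integral_const_mul, integral_compose_mul_conj_mode, integral_conj_compose_mul_mode]
  ring

end Modes

section Fields

open scoped FourierTransform SchwartzMap

variable {C D : ℕ} {A : Set (Coord D)} {B : Fin C → Type*}
  (b : ∀ j, ModeBasis A (B j)) (M : ∀ j, Finset (B j))

/-- Amplitudes of the modes of one component, extended by zero to all modes. -/
def extendAmp (j : Fin C) (α : AmpSpace (Mode M)) : Mode M → ℂ :=
  fun p => if p.1 = j then α p else 0

lemma sum_extendAmp (α : AmpSpace (Mode M)) : ∑ j, extendAmp M j α = α.ofLp := by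
  funext p
  simp [extendAmp, Finset.sum_apply]

/-- The field configuration with given mode amplitudes. -/
def fieldOf (α : AmpSpace (Mode M)) : FieldConfig b M :=
  fun j => compose (b j) (M j) (ampEquiv M α j)

lemma exists_fieldOf_eq (Ψ : FieldConfig b M) : ∃ α, fieldOf b M α = Ψ := by
  choose α hα using fun j => exists_compose_eq (b j) (M j) (Ψ j)
  exact ⟨(ampEquiv M).symm α, funext fun j => by
    rw [fieldOf, MeasurableEquiv.apply_symm_apply, hα]⟩

lemma displacementGenerator_fieldOf (j : Fin C) (α : AmpSpace (Mode M)) :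
    displacementGenerator b M j (fieldOf b M α j) = gen (extendAmp M j α) := by
  refine LinearMap.ext fun u => ?_
  rw [gen_apply, Fintype.sum_sigma, Finset.sum_eq_single j]
  · simp only [displacementGenerator, LinearMap.sum_apply, LinearMap.sub_apply,
      LinearMap.smul_apply, fieldOf, integral_compose_mul_conj_mode,
      integral_conj_compose_mul_mode, extendAmp, if_true, ampEquiv_apply]
  · intro i _ hi
    simp [extendAmp, hi]
  · simp

lemma gen_list_sum {μ : Type*} [Fintype μ] (L : List (μ → ℂ)) :
    gen L.sum = (L.map gen).sum := by
  induction L with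
  | nil => simp
  | cons a L ih => rw [List.sum_cons, gen_add, ih, List.map_cons, List.sum_cons]

lemma prod_map_expOperator_gen {μ : Type*} [Fintype μ] (L : List (μ → ℂ))
    (hL : L.Pairwise fun α β => Commute (gen α) (gen β)) :
    (L.map fun α => expOperator (gen α)).prod = expOperator (gen L.sum) := by
  induction L with
  | nil => simpa using (expOperator_gen_zero (μ := μ)).symm
  | cons a L ih =>
    rw [List.pairwise_cons] at hL
    rw [List.map_cons, List.prod_cons, ih hL.2, List.sum_cons, expOperator_gen_mul]
    rw [gen_list_sum]
    refine Commute.list_sum_right _ _ fun x hx => ?_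
    obtain ⟨β, hβ, rfl⟩ := List.mem_map.1 hx
    exact hL.1 β hβ

/-- The displacement operators of the components combine into one displacement operator. -/
lemma prod_displacementOp (α : AmpSpace (Mode M)) :
    (List.ofFn fun j => displacementOp b M j (fieldOf b M α j)).prod =
      expOperator (gen α.ofLp) := by
  have h := prod_map_expOperator_gen (List.ofFn fun j => extendAmp M j α) (by
    rw [List.pairwise_ofFn]
    intro i j hij
    refine commute_gen_of_disjoint fun p => ?_
    by_cases hp : p.1 = i
    · right; simp [extendAmp, hp, hij.ne]
    · left; simp [extendAmp, hp])
  rw [List.sum_ofFn, sum_extendAmp, List.map_ofFn] at h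
  have e : (fun j => displacementOp b M j (fieldOf b M α j)) =
      (fun β => expOperator (gen β)) ∘ fun j => extendAmp M j α := funext fun j => by
    rw [displacementOp, displacementGenerator_fieldOf, Function.comp_apply]
  rw [e]
  exact h

variable {ρ : DensityOperator (Mode M)}

lemma hasSum_diagonal_displacedState (hρ : ρ.HasFiniteMoments) (α : AmpSpace (Mode M)) :
    HasSum (diagonal (displacedState b M ρ (fieldOf b M α))) (charSchwartz hρ α) := by
  rw [displacedState, prod_displacementOp]
  exact hasSum_diagonal_mul_expOperator hρ α

lemma prod_displacementFunctional (α β : AmpSpace (Mode M)) :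
    ∏ j, displacementFunctional A (fieldOf b M α j).1 (fieldOf b M β j).1 =
      Complex.exp (((-2 * Real.pi * ⟪α, phaseVar β⟫_ℝ : ℝ) : ℂ) * Complex.I) := by
  rw [← phase_eq, Fintype.sum_sigma, Complex.exp_sum]
  exact Finset.prod_congr rfl fun j _ => displacementFunctional_compose (b j) (M j) _ _

lemma wignerIntegrand_fieldOf (hρ : ρ.HasFiniteMoments) (α β : AmpSpace (Mode M)) :
    wignerIntegrand b M ρ (fieldOf b M β) (fieldOf b M α) =
      Real.fourierChar (-⟪α, phaseVar β⟫_ℝ) • charSchwartz hρ α := by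
  rw [wignerIntegrand, prod_displacementFunctional, charFunctional, trace,
    (hasSum_diagonal_displacedState b M hρ α).tsum_eq, Circle.smul_def, Real.fourierChar_apply,
    smul_eq_mul]
  congr 3
  push_cast; ring

lemma funcIntegral_eq (F : FieldConfig b M → ℂ) :
    funcIntegral b M F = ∫ α : AmpSpace (Mode M), F (fieldOf b M α) :=
  ((measurePreserving_ampEquiv M).integral_comp (ampEquiv M).measurableEmbedding
    fun α => F fun j => compose (b j) (M j) (α j)).symm

lemma funcIntegrable_iff (F : FieldConfig b M → ℂ) :
    FuncIntegrable b M F ↔ Integrable fun α : AmpSpace (Mode M) => F (fieldOf b M α) :=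
  ((measurePreserving_ampEquiv M).integrable_comp_emb (ampEquiv M).measurableEmbedding
    (g := fun α => F fun j => compose (b j) (M j) (α j))).symm

/-- The Wigner functional is the Fourier transform of the characteristic function. -/
lemma wignerFunctional_fieldOf (hρ : ρ.HasFiniteMoments) (β : AmpSpace (Mode M)) :
    wignerFunctional b M ρ (fieldOf b M β) =
      ((Real.pi : ℂ) ^ (2 * Fintype.card (Mode M)))⁻¹ * 𝓕 (charSchwartz hρ) (phaseVar β) := by
  rw [wignerFunctional, funcIntegral_eq, SchwartzMap.fourier_coe, Real.fourier_eq]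
  simp only [wignerIntegrand_fieldOf b M hρ, Fintype.card_sigma, Fintype.card_coe]
  push_cast
  rw [one_div]

/-- The amplitudes of the annihilation part of the field operator. -/
def modeAmp (j : Fin C) (x : Coord D) : Mode M → ℂ :=
  fun p => if p.1 = j then (b p.1).φ p.2 x else 0

lemma fieldOp_eq_linOp (j : Fin C) (x : Coord D) :
    fieldOp b M j x = linOp (ladderAmp 0 (modeAmp b M j x)) := by
  rw [linOp_ladderAmp, Fintype.sum_sigma, Finset.sum_eq_single j]
  · simp [fieldOp, modeAmp]
  · intro i _ hi
    simp [modeAmp, hi]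
  · simp

lemma fieldOpDag_eq_linOp (j : Fin C) (x : Coord D) :
    fieldOpDag b M j x = linOp (ladderAmp (fun p => conj (modeAmp b M j x p)) 0) := by
  rw [linOp_ladderAmp, Fintype.sum_sigma, Finset.sum_eq_single j]
  · simp [fieldOpDag, modeAmp]
  · intro i _ hi
    simp [modeAmp, hi]
  · simp

lemma symbol_fieldOp (j : Fin C) (x : Coord D) (β : AmpSpace (Mode M)) :
    symbol (ladderAmp 0 (modeAmp b M j x)) (phaseVar β) = (fieldOf b M β j).1 x := by
  rw [symbol_ladderAmp, Fintype.sum_sigma, Finset.sum_eq_single j]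
  · simp [fieldOf, compose_apply, modeAmp, ampEquiv_apply, mul_comm]
  · intro i _ hi
    simp [modeAmp, hi]
  · simp

lemma symbol_fieldOpDag (j : Fin C) (x : Coord D) (β : AmpSpace (Mode M)) :
    symbol (ladderAmp (fun p => conj (modeAmp b M j x p)) 0) (phaseVar β) =
      conj ((fieldOf b M β j).1 x) := by
  rw [symbol_ladderAmp, Fintype.sum_sigma, Finset.sum_eq_single j]
  · simp [fieldOf, compose_apply, modeAmp, ampEquiv_apply, mul_comm]
  · intro i _ hi
    simp [modeAmp, hi]
  · simp

/-- The complexified amplitudes of the factors in `fieldFactors`. -/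
def factorAmps (r s : Fin C → ℕ) (x : Coord D) : List ((Mode M → ℂ) × (Mode M → ℂ)) :=
  (List.finRange C).flatMap fun j =>
    List.replicate (r j) (ladderAmp 0 (modeAmp b M j x)) ++
      List.replicate (s j) (ladderAmp (fun p => conj (modeAmp b M j x p)) 0)

lemma fieldFactors_eq (r s : Fin C → ℕ) (x : Coord D) :
    fieldFactors b M r s x = (factorAmps b M r s x).map linOp := by
  simp only [fieldFactors, factorAmps, List.map_flatMap, List.map_append, List.map_replicate,
    fieldOp_eq_linOp, fieldOpDag_eq_linOp]

lemma prod_symbol_factorAmps (r s : Fin C → ℕ) (x : Coord D) (β : AmpSpace (Mode M)) :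
    ((factorAmps b M r s x).map fun c => symbol c (phaseVar β)).prod =
      ∏ j, (fieldOf b M β j).1 x ^ r j * conj ((fieldOf b M β j).1 x) ^ s j := by
  rw [factorAmps, List.map_flatMap, List.flatMap_def, List.prod_flatten, List.map_map,
    Fin.prod_univ_def]
  congr 1
  refine List.map_congr_left fun j _ => ?_
  simp [symbol_fieldOp, symbol_fieldOpDag]

lemma momentIntegrand_fieldOf (hρ : ρ.HasFiniteMoments) (r s : Fin C → ℕ) (x : Coord D)
    (β : AmpSpace (Mode M)) :
    momentIntegrand b M ρ r s x (fieldOf b M β) =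
      ((Real.pi : ℂ) ^ (2 * Fintype.card (Mode M)))⁻¹ *
        (((factorAmps b M r s x).map fun c => symbol c (phaseVar β)).prod *
          𝓕 (charSchwartz hρ) (phaseVar β)) := by
  rw [momentIntegrand, wignerFunctional_fieldOf b M hρ, prod_symbol_factorAmps]
  ring

end Fields

end FuncWigner

end

theorem mainTheorem2 {C D : ℕ} {A : Set (Coord D)} {B : Fin C → Type*}
    (b : ∀ j, ModeBasis A (B j)) (M : ∀ j, Finset (B j))
    (ρ : DensityOperator (Mode M)) (hρ : ρ.HasFiniteMoments)
    (r s : Fin C → ℕ) (x : Coord D) :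
    (∀ Λ : FieldConfig b M, Summable (diagonal (displacedState b M ρ Λ))) ∧
    (∀ Ψ : FieldConfig b M, FuncIntegrable b M (wignerIntegrand b M ρ Ψ)) ∧
    FuncIntegrable b M (momentIntegrand b M ρ r s x) ∧
    Summable (ρ.diagonalMul (symProd (fieldFactors b M r s x))) ∧
    ρ.expectation (symProd (fieldFactors b M r s x)) =
      funcIntegral b M (momentIntegrand b M ρ r s x) := by
  obtain ⟨hint, hsum⟩ := hasSum_diagonalMul_symProd hρ (factorAmps b M r s x)
  rw [← fieldFactors_eq] at hsum
  refine ⟨fun Λ => ?_, fun Ψ => ?_, ?_, hsum.summable, ?_⟩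
  · obtain ⟨α, rfl⟩ := exists_fieldOf_eq b M Λ
    exact (hasSum_diagonal_displacedState b M hρ α).summable
  · obtain ⟨β, rfl⟩ := exists_fieldOf_eq b M Ψ
    rw [funcIntegrable_iff]
    simp only [wignerIntegrand_fieldOf b M hρ]
    exact (Real.fourierIntegral_convergent_iff _).2 (charSchwartz hρ).integrable
  · rw [funcIntegrable_iff]
    simp only [momentIntegrand_fieldOf b M hρ]
    exact (Integrable.comp_phaseVar hint).const_mul _
  · rw [DensityOperator.expectation, hsum.tsum_eq, funcIntegral_eq]
    simp only [momentIntegrand_fieldOf b M hρ]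
    have hpi : (Real.pi : ℂ) ^ (2 * Fintype.card (Mode M)) ≠ 0 :=
      pow_ne_zero _ (by exact_mod_cast Real.pi_ne_zero)
    rw [MeasureTheory.integral_const_mul, integral_comp_phaseVar fun ξ =>
      ((factorAmps b M r s x).map fun c => symbol c ξ).prod *
        FourierTransform.fourier (charSchwartz hρ) ξ, inv_mul_cancel_left₀ hpi]
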